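/- Let $M$ be a smooth manifold (Hausdorff, second countable, without boundary, not necessarily compact or connected) of dimension $n$. For $u,v\in\mathbb R^N$ let $u\odot v=(u_1v_1,\dots,u_Nv_N)$. A smooth map $f:M\to\mathbb R^N$ is called *free statistical* if for every $x\in M$ and all local coordinates $x_1,\dots,x_n$ of $M$ around $x$, with $f_i=\partial f/\partial x_i$ and $f_{ij}=\partial^2 f/\partial x_i\partial x_j$, the $$m_n=n+2\cdot\frac{n(n+1)}2+\binom{n+2}{3}=\frac{n(n^2+9n+14)}{6}$$ vectors $$f_i(x),\qquad f_{ij}(x)\ (i\le j),\qquad f_j(x)\odot f_k(x)\ (j\le k),\qquad f_i(x)\odot f_{jk}(x)+f_j(x)\odot f_{ik}(x)+f_k(x)\odot f_{ij}(x)\ (i\le j\le k)$$ are linearly independent in $\mathbb R^N$. Equip the space $C^\infty(M,\mathbb R^N)$ of smooth maps with the Whitney (fine, strong) $C^\infty$-topology. In this topology the basic neighbourhoods of $f$ are given by an order $r\in\mathbb N$ and a family $(\varphi_i,K_i,\varepsilon_i)_{i\in I}$ of smooth charts $\varphi_i$ of $M$, compact subsets $K_i$ of their domains forming a locally finite family in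 $M$, and numbers $\varepsilon_i>0$. The neighbourhood consists of all $g\in C^\infty(M,\mathbb R^N)$ such that $\|D^k(g\circ\varphi_i^{-1})(\varphi_i(x))-D^k(f\circ\varphi_i^{-1})(\varphi_i(x))\|<\varepsilon_i$ for all $i\in I$, $x\in K_i$ and $0\le k\le r$. **Proposition 3.2.** If $N\ge \dfrac{n(n^2+9n+20)}{6}$, then generic smooth maps $f:M\to\mathbb R^N$ are free statistical, that is, the free statistical maps form an open and dense subset of $C^\infty(M,\mathbb R^N)$ in the Whitney $C^\infty$-topology. -/

import Mathlib

open scoped Manifold ContDiff Topology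

noncomputable section

namespace FreeStat

/-- The space `C^∞(M, ℝ^N)` of smooth maps from an `n`-dimensional manifold `M` to `ℝ^N`. -/
abbrev SmoothMaps (n N : ℕ) (M : Type*) [TopologicalSpace M]
    [ChartedSpace (EuclideanSpace ℝ (Fin n)) M] :=
  ContMDiffMap (𝓡 n) (𝓡 N) M (EuclideanSpace ℝ (Fin N)) ∞

/-- The entrywise product `u ⊙ v = (u₁ v₁, …, u_N v_N)` on `ℝ^N`. -/
def odot {N : ℕ} (u v : EuclideanSpace ℝ (Fin N)) : EuclideanSpace ℝ (Fin N) :=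
  WithLp.toLp 2 (fun a => u a * v a)

/-- The partial derivative `∂F/∂x_i` of a map `F : ℝ^n → ℝ^N`. -/
def partialD {n N : ℕ} (i : Fin n)
    (F : EuclideanSpace ℝ (Fin n) → EuclideanSpace ℝ (Fin N)) :
    EuclideanSpace ℝ (Fin n) → EuclideanSpace ℝ (Fin N) :=
  fun y => fderiv ℝ F y (EuclideanSpace.single i 1)

/-- Index set of the vectors in the definition of a free statistical map: indices `i`, pairs
`i ≤ j`, pairs `j ≤ k`, and triples `i ≤ j ≤ k`. -/
abbrev FreeIndex (n : ℕ) :=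
  Fin n ⊕ {p : Fin n × Fin n // p.1 ≤ p.2} ⊕ {p : Fin n × Fin n // p.1 ≤ p.2} ⊕
    {t : Fin n × Fin n × Fin n // t.1 ≤ t.2.1 ∧ t.2.1 ≤ t.2.2}

/-- The vectors `F_i`, `F_ij`, `F_j ⊙ F_k` and `F_i ⊙ F_jk + F_j ⊙ F_ik + F_k ⊙ F_ij`
at the point `y`, for a map `F` defined near `y ∈ ℝ^n`. -/
def freeVectors {n N : ℕ} (F : EuclideanSpace ℝ (Fin n) → EuclideanSpace ℝ (Fin N))
    (y : EuclideanSpace ℝ (Fin n)) : FreeIndex n → EuclideanSpace ℝ (Fin N)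
  | .inl i => partialD i F y
  | .inr (.inl p) => partialD p.1.1 (partialD p.1.2 F) y
  | .inr (.inr (.inl p)) => odot (partialD p.1.1 F y) (partialD p.1.2 F y)
  | .inr (.inr (.inr t)) =>
      odot (partialD t.1.1 F y) (partialD t.1.2.1 (partialD t.1.2.2 F) y)
        + odot (partialD t.1.2.1 F y) (partialD t.1.1 (partialD t.1.2.2 F) y)
        + odot (partialD t.1.2.2 F y) (partialD t.1.1 (partialD t.1.2.1 F) y)

section Manifold

universe u

variable {n N : ℕ} {M : Type u} [TopologicalSpace M] [ChartedSpace (EuclideanSpace ℝ (Fin n)) M]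

/-- `f` is a free statistical map: at every point `x`, in local coordinates `φ` around `x`
(any smooth chart of `M`), the above vectors are linearly independent. -/
def IsFreeStatistical (f : SmoothMaps n N M) : Prop :=
  ∀ x : M, ∀ φ ∈ IsManifold.maximalAtlas (𝓡 n) ∞ M, x ∈ φ.source →
    LinearIndependent ℝ (freeVectors (f ∘ φ.symm) (φ x))

/-- The data of a basic neighbourhood in the Whitney topology: smooth charts `φ i`, compact sets
`K i` contained in their domains and forming a locally finite family, and numbers `ε i > 0`. -/
structure IsWhitneyData {ι : Type u}
    (φ : ι → OpenPartialHomeomorph M (EuclideanSpace ℝ (Fin n)))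
    (K : ι → Set M) (ε : ι → ℝ) : Prop where
  chart : ∀ i, φ i ∈ IsManifold.maximalAtlas (𝓡 n) ∞ M
  compact : ∀ i, IsCompact (K i)
  subset : ∀ i, K i ⊆ (φ i).source
  locallyFinite : LocallyFinite K
  pos : ∀ i, 0 < ε i

/-- The basic Whitney neighbourhood of `f` of order `r`: all `g` whose partial derivatives of
order `≤ r` in the chart `φ i` differ on `K i` by less than `ε i` from those of `f`, for all `i`. -/
def whitneyNhd (f : SmoothMaps n N M) (r : ℕ) {ι : Type u}
    (φ : ι → OpenPartialHomeomorph M (EuclideanSpace ℝ (Fin n)))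
    (K : ι → Set M) (ε : ι → ℝ) : Set (SmoothMaps n N M) :=
  {g | ∀ i, ∀ x ∈ K i, ∀ k ≤ r,
    ‖iteratedFDeriv ℝ k (g ∘ (φ i).symm) (φ i x)
      - iteratedFDeriv ℝ k (f ∘ (φ i).symm) (φ i x)‖ < ε i}

/-- Two Whitney neighbourhoods of `f` contain a common one. -/
theorem exists_whitneyNhd_subset_inter (f : SmoothMaps n N M) {r r' : ℕ} {ι ι' : Type u}
    {φ : ι → OpenPartialHomeomorph M (EuclideanSpace ℝ (Fin n))} {K : ι → Set M} {ε : ι → ℝ}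
    {φ' : ι' → OpenPartialHomeomorph M (EuclideanSpace ℝ (Fin n))} {K' : ι' → Set M} {ε' : ι' → ℝ}
    (h : IsWhitneyData φ K ε) (h' : IsWhitneyData φ' K' ε') :
    IsWhitneyData (Sum.elim φ φ') (Sum.elim K K') (Sum.elim ε ε') ∧
      whitneyNhd f (max r r') (Sum.elim φ φ') (Sum.elim K K') (Sum.elim ε ε') ⊆
        whitneyNhd f r φ K ε ∩ whitneyNhd f r' φ' K' ε' := by
  refine ⟨⟨?_, ?_, ?_, h.locallyFinite.sumElim h'.locallyFinite, ?_⟩, fun g hg =>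
    ⟨fun i x hx k hk => hg (.inl i) x hx k (le_max_of_le_left hk),
      fun i x hx k hk => hg (.inr i) x hx k (le_max_of_le_right hk)⟩⟩
  · rintro (i | i)
    exacts [h.chart i, h'.chart i]
  · rintro (i | i)
    exacts [h.compact i, h'.compact i]
  · rintro (i | i)
    exacts [h.subset i, h'.subset i]
  · rintro (i | i)
    exacts [h.pos i, h'.pos i]

variable (n N M) in
/-- The Whitney (fine, strong) `C^∞`-topology on the space of smooth maps `M → ℝ^N`: a set is open
if with each of its points it contains a basic Whitney neighbourhood of some finite order. -/
@[reducible]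
def whitneyTopology : TopologicalSpace (SmoothMaps n N M) where
  IsOpen U := ∀ f ∈ U, ∃ (r : ℕ) (ι : Type u)
    (φ : ι → OpenPartialHomeomorph M (EuclideanSpace ℝ (Fin n))) (K : ι → Set M) (ε : ι → ℝ),
    IsWhitneyData φ K ε ∧ whitneyNhd f r φ K ε ⊆ U
  isOpen_univ := fun _ _ =>
    ⟨0, PEmpty, PEmpty.elim, PEmpty.elim, PEmpty.elim,
      ⟨fun i => i.elim, fun i => i.elim, fun i => i.elim, locallyFinite_of_finite _,
        fun i => i.elim⟩, fun _ _ => trivial⟩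
  isOpen_inter := by
    rintro U V hU hV f ⟨hfU, hfV⟩
    obtain ⟨r, ι, φ, K, ε, hd, hs⟩ := hU f hfU
    obtain ⟨r', ι', φ', K', ε', hd', hs'⟩ := hV f hfV
    obtain ⟨hd₀, hs₀⟩ := exists_whitneyNhd_subset_inter f (r := r) (r' := r') hd hd'
    exact ⟨_, _, _, _, _, hd₀, hs₀.trans (Set.inter_subset_inter hs hs')⟩
  isOpen_sUnion := by
    rintro S hS f ⟨U, hU, hf⟩
    obtain ⟨r, ι, φ, K, ε, hd, hs⟩ := hS U hU f hf
    exact ⟨r, ι, φ, K, ε, hd, hs.trans (Set.subset_sUnion_of_mem hU)⟩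

end Manifold

end FreeStat

end

/-!
Openness holds because freeness at a point is an open condition on the second-order jet and does not
depend on the chart: under a change of coordinates the vectors of the definition, taken along all
directions, keep their span (`linearIndependent_freeVectors_of_chart`). So a locally finite cover by
compact sets in chart domains yields a Whitney neighbourhood of order two
(`isOpen_setOf_isFreeStatistical`).

Density rests on a dimension count. Let `m` be the number of vectors. If the vectors at a point `y`
satisfy a nontrivial relation with coefficients `l`, then the second-order jet `z` of each of the
`N` components is a zero of the polynomial `∑ t, l t * freeMonomial z t`. This polynomial is nonzero
of degree at most two, so at a singular point of its zero set some partial derivative of it has a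
regular zero (`exists_relation_eq_zero`). Normalising one coefficient of `l` to one, the
triples `(y, l, z)` therefore lie in finitely many sets on each of which `N + 1` functions with
independent derivatives vanish (`dimH_degenerateJets_le`). Adding to a map defined on an open subset
of `ℝ^n` a quadratic polynomial map with coefficients `c` changes its jet at `y` by an arbitrary
amount, and `c` is a smooth function of `y` and of the new jet. So the coefficients for which
freeness fails somewhere have codimension at least `(N + 1) - n - m`, which is positive
(`dense_setOf_linearIndependent_freeVectors`).

On the manifold, perturbations of this kind are cut off by a locally finite family of bump functions
and added up. If the coefficients of each are bounded by a suitable constant, the sum stays in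
a given Whitney neighbourhood (`exists_norm_iteratedFDeriv_perturbation_le`). The admissible
coefficients form a compact space, in which freeness on each of countably many compact sets is an
open and dense condition, so Baire's theorem provides a free perturbation
(`exists_isFreeStatistical_perturb`).
-/

open scoped Manifold ContDiff Topology

noncomputable section

namespace FreeStat

/-! ### The quadratic forms behind freeness -/

/-- Index set of the partial derivatives of order one and two of a map defined on `ℝ^n`: an index
`i` stands for `∂_i`, a pair `i ≤ j` for `∂_i ∂_j`. -/
abbrev JetIndex (n : ℕ) := Fin n ⊕ {p : Fin n × Fin n // p.1 ≤ p.2}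

/-- The partial derivatives of order one and two of `F` at `y`. -/
def jet {n N : ℕ} (F : EuclideanSpace ℝ (Fin n) → EuclideanSpace ℝ (Fin N))
    (y : EuclideanSpace ℝ (Fin n)) : JetIndex n → EuclideanSpace ℝ (Fin N)
  | .inl i => partialD i F y
  | .inr p => partialD p.1.1 (partialD p.1.2 F) y

section Monomials

variable {n : ℕ}

/-- The entry of the vector `freeVectors F y t` in some component, as a function of the partial
derivatives of that component: a polynomial of degree at most two. -/
def freeMonomial (z : JetIndex n → ℝ) : FreeIndex n → ℝ
  | .inl i => z (.inl i)
  | .inr (.inl p) => z (.inr p)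
  | .inr (.inr (.inl p)) => z (.inl p.1.1) * z (.inl p.1.2)
  | .inr (.inr (.inr t)) =>
      z (.inl t.1.1) * z (.inr ⟨(t.1.2.1, t.1.2.2), t.2.2⟩)
        + z (.inl t.1.2.1) * z (.inr ⟨(t.1.1, t.1.2.2), t.2.1.trans t.2.2⟩)
        + z (.inl t.1.2.2) * z (.inr ⟨(t.1.1, t.1.2.1), t.2.1⟩)

theorem freeVectors_apply {N : ℕ} (F : EuclideanSpace ℝ (Fin n) → EuclideanSpace ℝ (Fin N))
    (y : EuclideanSpace ℝ (Fin n)) (t : FreeIndex n) (a : Fin N) :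
    freeVectors F y t a = freeMonomial (fun s => jet F y s a) t := by
  rcases t with i | p | p | t <;> simp [freeVectors, freeMonomial, jet, odot]

/-- The second derivative of `freeMonomial` in the directions `v` and `w`, which does not depend on
the base point. -/
def freeMonomial₂ (v w : JetIndex n → ℝ) : FreeIndex n → ℝ
  | .inl _ => 0
  | .inr (.inl _) => 0
  | .inr (.inr (.inl p)) => v (.inl p.1.1) * w (.inl p.1.2) + w (.inl p.1.1) * v (.inl p.1.2)
  | .inr (.inr (.inr t)) =>
      (v (.inl t.1.1) * w (.inr ⟨(t.1.2.1, t.1.2.2), t.2.2⟩)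
        + v (.inl t.1.2.1) * w (.inr ⟨(t.1.1, t.1.2.2), t.2.1.trans t.2.2⟩)
        + v (.inl t.1.2.2) * w (.inr ⟨(t.1.1, t.1.2.1), t.2.1⟩))
      + (w (.inl t.1.1) * v (.inr ⟨(t.1.2.1, t.1.2.2), t.2.2⟩)
        + w (.inl t.1.2.1) * v (.inr ⟨(t.1.1, t.1.2.2), t.2.1.trans t.2.2⟩)
        + w (.inl t.1.2.2) * v (.inr ⟨(t.1.1, t.1.2.1), t.2.1⟩))

/-- The linear part of `freeMonomial`. -/
def freeMonomialLin (v : JetIndex n → ℝ) : FreeIndex n → ℝ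
  | .inl i => v (.inl i)
  | .inr (.inl p) => v (.inr p)
  | .inr (.inr _) => 0

/-- The derivative of `freeMonomial` at `z` in the direction `v`. -/
def freeMonomial₁ (z v : JetIndex n → ℝ) (t : FreeIndex n) : ℝ :=
  freeMonomialLin v t + freeMonomial₂ z v t

theorem freeMonomial_add_smul (z v : JetIndex n → ℝ) (r : ℝ) (t : FreeIndex n) :
    freeMonomial (z + r • v) t
      = freeMonomial z t + r * freeMonomial₁ z v t + r ^ 2 * (freeMonomial₂ v v t / 2) := by
  rcases t with i | p | p | t <;>
    simp [freeMonomial, freeMonomial₁, freeMonomialLin, freeMonomial₂] <;> ring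

theorem freeMonomial₁_add_smul (z w v : JetIndex n → ℝ) (r : ℝ) (t : FreeIndex n) :
    freeMonomial₁ (z + r • w) v t = freeMonomial₁ z v t + r * freeMonomial₂ w v t := by
  rcases t with i | p | p | t <;>
    simp [freeMonomial₁, freeMonomialLin, freeMonomial₂] <;> ring

/-- Combinations of the polynomials `freeMonomial` have degree two, so one of them is zero as soon
as its first derivatives at one point and its second derivatives vanish; and the polynomials
`freeMonomial` are linearly independent. -/
theorem eq_zero_of_derivatives_eq_zero {l : FreeIndex n → ℝ} (z : JetIndex n → ℝ)
    (h₁ : ∀ d, ∑ t, l t * freeMonomial₁ z (Pi.single d 1) t = 0)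
    (h₂ : ∀ d e, ∑ t, l t * freeMonomial₂ (Pi.single e 1) (Pi.single d 1) t = 0) : l = 0 := by
  have key : ∀ (c : FreeIndex n → ℝ) (t₀ : FreeIndex n), (∀ t, t ≠ t₀ → l t * c t = 0) →
      c t₀ ≠ 0 → ∑ t, l t * c t = 0 → l t₀ = 0 := by
    intro c t₀ hc hc₀ h
    rw [Finset.sum_eq_single t₀ (fun t _ ht => hc t ht) (by simp)] at h
    exact (mul_eq_zero.1 h).resolve_right hc₀
  -- each coefficient of degree two is isolated by one second derivative: those of products of first
  -- derivatives by `(j, k)`, those of the symmetrised products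
  -- by the first derivative `i` and the pair `(j, k)`
  have hq : ∀ p, l (.inr (.inr (.inl p))) = 0 := by
    rintro ⟨⟨j, k⟩, hjk⟩
    refine key _ _ ?_ ?_ (h₂ (.inl j) (.inl k))
    · rintro (i | p | ⟨⟨j', k'⟩, hjk'⟩ | t) ht <;> simp [freeMonomial₂, Pi.single_apply]
      right
      have : ¬ (j' = j ∧ k' = k) := by rintro ⟨rfl, rfl⟩; exact ht rfl
      split_ifs <;> grind
    · simp only [freeMonomial₂, Pi.single_apply, Sum.inl.injEq]
      split_ifs <;> norm_num
  have hc : ∀ t, l (.inr (.inr (.inr t))) = 0 := by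
    rintro ⟨⟨i, j, k⟩, hij, hjk⟩
    refine key _ _ ?_ ?_ (h₂ (.inr ⟨(j, k), hjk⟩) (.inl i))
    · rintro (i | p | ⟨⟨j', k'⟩, hjk'⟩ | ⟨⟨i', j', k'⟩, hij', hjk'⟩) ht <;>
        simp [freeMonomial₂, Pi.single_apply]
      right
      have : ¬ (i' = i ∧ j' = j ∧ k' = k) := by rintro ⟨rfl, rfl, rfl⟩; exact ht rfl
      simp only at hij' hjk' hij hjk
      split_ifs <;> grind
    · simp only [freeMonomial₂, Pi.single_apply, Sum.inl.injEq, Sum.inr.injEq, reduceCtorEq]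
      norm_num
      positivity
  -- now only the linear part is left
  have hl : ∀ d, ∑ t, l t * freeMonomialLin (Pi.single d 1) t = 0 := by
    intro d
    rw [← h₁ d]
    refine Finset.sum_congr rfl fun t _ => ?_
    rcases t with i | p | p | t <;> simp [freeMonomial₁, freeMonomial₂, hq, hc]
  ext t
  rcases t with i | p | p | t
  · refine key _ _ ?_ ?_ (hl (.inl i))
    · rintro (i' | p' | p' | t) ht <;> simp [freeMonomialLin, Pi.single_apply]
      rintro rfl; exact absurd rfl ht
    · simp [freeMonomialLin]
  · refine key _ _ ?_ ?_ (hl (.inr p))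
    · rintro (i' | p' | p' | t) ht <;> simp [freeMonomialLin, Pi.single_apply]
      rintro rfl; exact absurd rfl ht
    · simp [freeMonomialLin]
  · exact hq p
  · exact hc t

/-- The polynomial `∑ t, l t * freeMonomial z t` of `z` (for `d = none`), or its derivative in the
coordinate direction `d`. -/
def relation (d : Option (JetIndex n)) (l : FreeIndex n → ℝ) (z : JetIndex n → ℝ) : ℝ :=
  match d with
  | none => ∑ t, l t * freeMonomial z t
  | some d => ∑ t, l t * freeMonomial₁ z (Pi.single d 1) t

/-- The derivative of `relation d l` at `z` in the coordinate direction `e`. -/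
def relationDeriv (d : Option (JetIndex n)) (l : FreeIndex n → ℝ) (z : JetIndex n → ℝ)
    (e : JetIndex n) : ℝ :=
  match d with
  | none => ∑ t, l t * freeMonomial₁ z (Pi.single e 1) t
  | some d => ∑ t, l t * freeMonomial₂ (Pi.single e 1) (Pi.single d 1) t

/-- A zero of a nonzero combination of the polynomials `freeMonomial` may be a singular point of its
zero set, but then it is a regular point of the zero set of some derivative. -/
theorem exists_relation_eq_zero {l : FreeIndex n → ℝ} (hl : l ≠ 0) {z : JetIndex n → ℝ}
    (hz : ∑ t, l t * freeMonomial z t = 0) :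
    ∃ d, relation d l z = 0 ∧ ∃ e, relationDeriv d l z e ≠ 0 := by
  by_contra! h
  have h₁ : ∀ d, ∑ t, l t * freeMonomial₁ z (Pi.single d 1) t = 0 := h none hz
  exact hl (eq_zero_of_derivatives_eq_zero z h₁ fun d => h (some d) (h₁ d))

theorem hasLineDerivAt_relation (d : Option (JetIndex n)) (l : FreeIndex n → ℝ)
    (z : JetIndex n → ℝ) (e : JetIndex n) :
    HasLineDerivAt ℝ (relation d l) (relationDeriv d l z e) z (Pi.single e 1) := by
  unfold HasLineDerivAt
  cases d with
  | none =>
    simp only [relation, relationDeriv, freeMonomial_add_smul]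
    refine HasDerivAt.fun_sum fun t _ => HasDerivAt.const_mul _ ?_
    have h := (((hasDerivAt_id (0 : ℝ)).mul_const (freeMonomial₁ z (Pi.single e 1) t)).const_add
      (freeMonomial z t)).fun_add (((hasDerivAt_id (0 : ℝ)).pow 2).mul_const
        (freeMonomial₂ (Pi.single e 1) (Pi.single e 1) t / 2))
    simpa using h
  | some d =>
    simp only [relation, relationDeriv, freeMonomial₁_add_smul]
    refine HasDerivAt.fun_sum fun t _ => HasDerivAt.const_mul _ ?_
    have h := ((hasDerivAt_id (0 : ℝ)).mul_const
      (freeMonomial₂ (Pi.single e 1) (Pi.single d 1) t)).const_add (freeMonomial₁ z (Pi.single d 1) t)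
    simpa using h

theorem contDiff_relation (d : Option (JetIndex n)) :
    ContDiff ℝ ∞ fun x : (FreeIndex n → ℝ) × (JetIndex n → ℝ) => relation d x.1 x.2 := by
  cases d with
  | none =>
    refine ContDiff.sum fun t _ => ContDiff.mul (by fun_prop) ?_
    rcases t with i | p | p | t <;> simp only [freeMonomial] <;> fun_prop
  | some d =>
    refine ContDiff.sum fun t _ => ContDiff.mul (by fun_prop) ?_
    rcases t with i | p | p | t <;>
      simp only [freeMonomial₁, freeMonomialLin, freeMonomial₂] <;> fun_prop

end Monomials

section Card

theorem card_pairs_le (n : ℕ) :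
    Fintype.card {p : Fin n × Fin n // p.1 ≤ p.2} ≤ n.multichoose 2 := by
  have h := Fintype.card_le_of_injective (β := Sym (Fin n) 2)
    (fun p : {p : Fin n × Fin n // p.1 ≤ p.2} =>
      (⟨(([p.1.1, p.1.2] : List (Fin n)) : Multiset (Fin n)), rfl⟩ : Sym (Fin n) 2)) ?_
  · simpa [Sym.card_sym_eq_multichoose] using h
  · rintro ⟨⟨i, j⟩, hij⟩ ⟨⟨i', j'⟩, hij'⟩ h
    have h' := Multiset.coe_eq_coe.1 (Subtype.ext_iff.1 h)
    have h'' := h'.eq_of_pairwise (le := (· ≤ ·)) (by grind) (by simpa using hij)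
      (by simpa using hij')
    simpa using h''

theorem card_triples_le (n : ℕ) :
    Fintype.card {t : Fin n × Fin n × Fin n // t.1 ≤ t.2.1 ∧ t.2.1 ≤ t.2.2}
      ≤ n.multichoose 3 := by
  have h := Fintype.card_le_of_injective (β := Sym (Fin n) 3)
    (fun t : {t : Fin n × Fin n × Fin n // t.1 ≤ t.2.1 ∧ t.2.1 ≤ t.2.2} =>
      (⟨(([t.1.1, t.1.2.1, t.1.2.2] : List (Fin n)) : Multiset (Fin n)), rfl⟩ : Sym (Fin n) 3)) ?_
  · simpa [Sym.card_sym_eq_multichoose] using h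
  · rintro ⟨⟨i, j, k⟩, hij, hjk⟩ ⟨⟨i', j', k'⟩, hij', hjk'⟩ h
    have h' := Multiset.coe_eq_coe.1 (Subtype.ext_iff.1 h)
    have h'' := h'.eq_of_pairwise (le := (· ≤ ·)) (by grind)
      (by simp only at hij hjk; simpa [hij, hjk] using hij.trans hjk)
      (by simp only at hij' hjk'; simpa [hij', hjk'] using hij'.trans hjk')
    simpa using h''

theorem two_mul_multichoose_two (n : ℕ) : 2 * n.multichoose 2 = n * (n + 1) := by
  induction n with
  | zero => simp
  | succ n ih =>
    rw [Nat.multichoose_succ_succ, Nat.multichoose_one_right]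
    linarith

theorem six_mul_multichoose_three (n : ℕ) : 6 * n.multichoose 3 = n * (n + 1) * (n + 2) := by
  induction n with
  | zero => simp
  | succ n ih =>
    have h := two_mul_multichoose_two (n + 1)
    rw [Nat.multichoose_succ_succ]
    linarith

theorem six_mul_card_freeIndex_le (n : ℕ) :
    6 * Fintype.card (FreeIndex n) ≤ n * (n ^ 2 + 9 * n + 14) := by
  simp only [Fintype.card_sum, Fintype.card_fin]
  nlinarith [card_pairs_le n, card_triples_le n, two_mul_multichoose_two n,
    six_mul_multichoose_three n]

end Card

/-! ### Hausdorff dimension of sets cut out by independent equations -/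

section Dimension

open Module

/-- A set on which `c` functions with linearly independent derivatives vanish has codimension at
least `c`. -/
theorem dimH_le_of_hasStrictFDerivAt {X κ : Type*} [NormedAddCommGroup X] [NormedSpace ℝ X]
    [FiniteDimensional ℝ X] [Fintype κ] {A : Set X} {G : X → κ → ℝ} {d : ℕ}
    (hd : finrank ℝ X ≤ d + Fintype.card κ) (h0 : ∀ x ∈ A, G x = 0)
    (hG : ∀ x ∈ A, ∃ G' : X →L[ℝ] (κ → ℝ), HasStrictFDerivAt G G' x ∧ Function.Surjective G') :
    dimH A ≤ d := by
  have := FiniteDimensional.complete ℝ X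
  by_contra! hlt
  obtain ⟨x, hxA, hx⟩ := exists_mem_nhdsWithin_lt_dimH_of_lt_dimH hlt
  obtain ⟨G', hG', hs⟩ := hG x hxA
  have hr : G'.range = ⊤ := LinearMap.range_eq_top.2 hs
  -- near `x` the set is the graph of the implicit function over the kernel of the derivative
  obtain ⟨K, V, hV, hK⟩ := (hG'.to_implicitFunction hr).exists_lipschitzOnWith
  have hcont : ContinuousAt (hG'.implicitToOpenPartialHomeomorph G G' hr) x :=
    (hG'.implicitToOpenPartialHomeomorph G G' hr).continuousAt
      (hG'.mem_implicitToOpenPartialHomeomorph_source hr)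
  have hsnd : ∀ᶠ y in 𝓝 x, (hG'.implicitToOpenPartialHomeomorph G G' hr y).2 ∈ V := by
    refine hcont.snd.eventually_mem ?_
    simpa using hV
  have hmem : {y | y ∈ A ∧ (hG'.implicitToOpenPartialHomeomorph G G' hr y).2 ∈ V ∧
      hG'.implicitFunction G G' hr (G y) (hG'.implicitToOpenPartialHomeomorph G G' hr y).2 = y}
        ∈ 𝓝[A] x := by
    filter_upwards [self_mem_nhdsWithin, mem_nhdsWithin_of_mem_nhds hsnd,
      mem_nhdsWithin_of_mem_nhds (hG'.eq_implicitFunction hr)] with y h1 h2 h3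
    exact ⟨h1, h2, h3⟩
  refine (hx _ hmem).not_ge ?_
  have hsub : {y | y ∈ A ∧ (hG'.implicitToOpenPartialHomeomorph G G' hr y).2 ∈ V ∧
      hG'.implicitFunction G G' hr (G y) (hG'.implicitToOpenPartialHomeomorph G G' hr y).2 = y}
        ⊆ hG'.implicitFunction G G' hr (G x) '' V := by
    rintro y ⟨h1, h2, h3⟩
    refine ⟨_, h2, ?_⟩
    rwa [h0 x hxA, ← h0 y h1]
  have hrank := (G' : X →ₗ[ℝ] (κ → ℝ)).finrank_range_add_finrank_ker
  have hr' : finrank ℝ (LinearMap.range (G' : X →ₗ[ℝ] (κ → ℝ))) = Fintype.card κ := by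
    have : LinearMap.range (G' : X →ₗ[ℝ] (κ → ℝ)) = ⊤ := hr
    rw [this, finrank_top, finrank_fintype_fun_eq_card]
  calc dimH _ ≤ dimH (hG'.implicitFunction G G' hr (G x) '' V) := dimH_mono hsub
    _ ≤ dimH V := hK.dimH_image_le
    _ ≤ dimH (Set.univ : Set G'.ker) := dimH_mono (Set.subset_univ _)
    _ = finrank ℝ G'.ker := Real.dimH_univ_eq_finrank _
    _ ≤ d := by
      have : finrank ℝ G'.ker ≤ d := by
        omega
      exact_mod_cast this

end Dimension

section Degenerate

open Module

variable {n N : ℕ}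

/-- Second-order jets together with a linear relation between the vectors in the definition of
freeness: the coefficient of index `j` of the relation is one, and in the component `a` the relation
shows up as a regular zero of `relation (σ a)`. The base point in `ℝ^n` is arbitrary. -/
def degenerateJets (n N : ℕ) (j : FreeIndex n) (σ : Fin N → Option (JetIndex n)) :
    Set (EuclideanSpace ℝ (Fin n) × (FreeIndex n → ℝ) × (Fin N → JetIndex n → ℝ)) :=
  {x | x.2.1 j = 1 ∧ ∀ a, relation (σ a) x.2.1 (x.2.2 a) = 0 ∧
    ∃ e, relationDeriv (σ a) x.2.1 (x.2.2 a) e ≠ 0}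

theorem dimH_degenerateJets_le (j : FreeIndex n) (σ : Fin N → Option (JetIndex n)) {d : ℕ}
    (hd : n + Fintype.card (FreeIndex n) + N * Fintype.card (JetIndex n) ≤ d + (N + 1)) :
    dimH (degenerateJets n N j σ) ≤ d := by
  let R : (EuclideanSpace ℝ (Fin n) × (FreeIndex n → ℝ) × (Fin N → JetIndex n → ℝ)) → Fin N → ℝ :=
    fun x a => relation (σ a) x.2.1 (x.2.2 a)
  let G : (EuclideanSpace ℝ (Fin n) × (FreeIndex n → ℝ) × (Fin N → JetIndex n → ℝ)) →
      Option (Fin N) → ℝ := fun x o => o.elim (x.2.1 j - 1) (R x)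
  have hR : ∀ a, ContDiff ℝ ∞ fun x => R x a := fun a =>
    (contDiff_relation (σ a)).comp (f := fun x : (EuclideanSpace ℝ (Fin n) × (FreeIndex n → ℝ) ×
      (Fin N → JetIndex n → ℝ)) => (x.2.1, x.2.2 a)) (by fun_prop)
  have hGd : ContDiff ℝ ∞ G := by
    rw [contDiff_pi]
    rintro (_ | a)
    · change ContDiff ℝ ∞ fun x : (EuclideanSpace ℝ (Fin n) × (FreeIndex n → ℝ) ×
        (Fin N → JetIndex n → ℝ)) => x.2.1 j - 1
      fun_prop
    · exact hR a
  refine dimH_le_of_hasStrictFDerivAt (G := G) ?_ ?_ ?_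
  · simp [finrank_pi_fintype]
    simp at hd
    omega
  · rintro x ⟨h1, h2⟩
    ext o
    cases o with
    | none => simp [G, h1]
    | some a => exact (h2 a).1
  · rintro ⟨y, l, z⟩ ⟨h1, h2⟩
    refine ⟨_, hGd.contDiffAt.hasStrictFDerivAt (by simp), fun t => ?_⟩
    choose e he using fun a => (h2 a).2
    simp only at he
    have hfd : ∀ v, fderiv ℝ G (y, l, z) v = fun o => fderiv ℝ (fun x => G x o) (y, l, z) v := by
      intro v
      rw [fderiv_pi fun o => (contDiff_pi.1 hGd o).contDiffAt.differentiableAt (by simp)]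
      rfl
    have hnone : ∀ v, fderiv ℝ (fun x => G x none) (y, l, z) v = v.2.1 j := by
      intro v
      let p : (EuclideanSpace ℝ (Fin n) × (FreeIndex n → ℝ) × (Fin N → JetIndex n → ℝ)) →L[ℝ] ℝ :=
        (ContinuousLinearMap.proj (R := ℝ) j).comp ((ContinuousLinearMap.fst ℝ _ _).comp
          (ContinuousLinearMap.snd ℝ _ _))
      have : HasFDerivAt (fun x => G x none) p (y, l, z) := p.hasFDerivAt.sub_const (1 : ℝ)
      rw [this.fderiv]
      rfl
    have hsome : ∀ a (w : Fin N → JetIndex n → ℝ) (r : ℝ), w a = r • Pi.single (e a) 1 →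
        fderiv ℝ (fun x => G x (some a)) (y, l, z) (0, 0, w)
          = r * relationDeriv (σ a) l (z a) (e a) := by
      intro a w r hw
      have hfd := (hR a).contDiffAt (x := (y, l, z)) |>.differentiableAt (by simp)
      have hl := hfd.hasFDerivAt.hasLineDerivAt (0, 0, w)
      have hl' := (hasLineDerivAt_relation (σ a) l (z a) (e a)).smul r
      have : HasLineDerivAt ℝ (fun x => R x a) (r • relationDeriv (σ a) l (z a) (e a))
          (y, l, z) (0, 0, w) := by
        unfold HasLineDerivAt at hl' ⊢
        convert hl' using 2
        simp [R, hw]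
      exact hl.unique this
    -- first adjust the coefficient `j`, then each component along its regular direction
    let u : EuclideanSpace ℝ (Fin n) × (FreeIndex n → ℝ) × (Fin N → JetIndex n → ℝ) :=
      (0, t none • Pi.single j 1, 0)
    let r : Fin N → ℝ := fun a => (t (some a) - fderiv ℝ (fun x => G x (some a)) (y, l, z) u)
      / relationDeriv (σ a) l (z a) (e a)
    refine ⟨u + (0, 0, fun a => r a • Pi.single (e a) 1), ?_⟩
    rw [hfd]
    ext o
    cases o with
    | none => simp [hnone, u]
    | some a =>
      rw [map_add, hsome a _ (r a) rfl]
      simp only [r]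
      rw [div_mul_cancel₀ _ (he a)]
      ring

end Degenerate

/-! ### Quadratic perturbations of a map on an open subset of `ℝ^n` -/

section Perturbation

variable {n N : ℕ}

theorem partialD_add {F G : EuclideanSpace ℝ (Fin n) → EuclideanSpace ℝ (Fin N)}
    {y : EuclideanSpace ℝ (Fin n)} (hF : DifferentiableAt ℝ F y) (hG : DifferentiableAt ℝ G y)
    (i : Fin n) : partialD i (F + G) y = partialD i F y + partialD i G y := by
  simp [partialD, fderiv_add hF hG]

theorem partialD_congr {F G : EuclideanSpace ℝ (Fin n) → EuclideanSpace ℝ (Fin N)}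
    {y : EuclideanSpace ℝ (Fin n)} (h : F =ᶠ[𝓝 y] G) (i : Fin n) :
    partialD i F =ᶠ[𝓝 y] partialD i G :=
  (h.fderiv (𝕜 := ℝ)).mono fun z hz => by simp [partialD, hz]

theorem jet_congr {F G : EuclideanSpace ℝ (Fin n) → EuclideanSpace ℝ (Fin N)}
    {y : EuclideanSpace ℝ (Fin n)} (h : F =ᶠ[𝓝 y] G) : jet F y = jet G y := by
  ext1 s
  rcases s with i | p
  · exact (partialD_congr h i).eq_of_nhds
  · exact (partialD_congr (partialD_congr h p.1.2) p.1.1).eq_of_nhds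

theorem freeVectors_congr {F G : EuclideanSpace ℝ (Fin n) → EuclideanSpace ℝ (Fin N)}
    {y : EuclideanSpace ℝ (Fin n)} (h : F =ᶠ[𝓝 y] G) : freeVectors F y = freeVectors G y := by
  ext t a
  rw [freeVectors_apply, freeVectors_apply, jet_congr h]

theorem contDiffAt_partialD {F : EuclideanSpace ℝ (Fin n) → EuclideanSpace ℝ (Fin N)}
    {y : EuclideanSpace ℝ (Fin n)} (h : ContDiffAt ℝ ∞ F y) (i : Fin n) :
    ContDiffAt ℝ ∞ (partialD i F) y :=
  (h.fderiv_right (m := ∞) (by simp)).clm_apply contDiffAt_const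

theorem contDiffAt_jet {F : EuclideanSpace ℝ (Fin n) → EuclideanSpace ℝ (Fin N)}
    {y : EuclideanSpace ℝ (Fin n)} (h : ContDiffAt ℝ ∞ F y) (s : JetIndex n) :
    ContDiffAt ℝ ∞ (fun y => jet F y s) y := by
  rcases s with i | p
  · exact contDiffAt_partialD h i
  · exact contDiffAt_partialD (contDiffAt_partialD h _) _

theorem jet_add {F G : EuclideanSpace ℝ (Fin n) → EuclideanSpace ℝ (Fin N)}
    {y : EuclideanSpace ℝ (Fin n)} (hF : ContDiffAt ℝ ∞ F y) (hG : ContDiffAt ℝ ∞ G y) :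
    jet (F + G) y = jet F y + jet G y := by
  have hd : ∀ i, partialD i (F + G) =ᶠ[𝓝 y] partialD i F + partialD i G := by
    intro i
    have hF' : ∀ᶠ z in 𝓝 y, ContDiffAt ℝ 1 F z := (hF.of_le (by simp)).eventually (by simp)
    have hG' : ∀ᶠ z in 𝓝 y, ContDiffAt ℝ 1 G z := (hG.of_le (by simp)).eventually (by simp)
    filter_upwards [hF', hG'] with z h1 h2
    exact partialD_add (h1.differentiableAt (by simp)) (h2.differentiableAt (by simp)) i
  ext1 s
  rcases s with i | p
  · exact (hd i).eq_of_nhds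
  · change partialD p.1.1 (partialD p.1.2 (F + G)) y = _
    rw [(partialD_congr (hd p.1.2) p.1.1).eq_of_nhds]
    exact partialD_add ((contDiffAt_partialD hF _).differentiableAt (by simp))
      ((contDiffAt_partialD hG _).differentiableAt (by simp)) _

/-- The monomials `y_i`, `y_i y_j` for `i < j`, and `y_i ^ 2 / 2`; the coefficients are those for
which the second derivatives are zero or one. -/
def quadMonomial (s : JetIndex n) (y : EuclideanSpace ℝ (Fin n)) : ℝ :=
  match s with
  | .inl i => y i
  | .inr p => (if p.1.1 = p.1.2 then 1 / 2 else 1) * (y p.1.1 * y p.1.2)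

/-- The partial derivative `∂_i` of `quadMonomial s`. -/
def quadMonomial₁ (i : Fin n) (s : JetIndex n) (y : EuclideanSpace ℝ (Fin n)) : ℝ :=
  match s with
  | .inl k => if i = k then 1 else 0
  | .inr p => (if p.1.1 = p.1.2 then 1 / 2 else 1) *
      ((if i = p.1.1 then 1 else 0) * y p.1.2 + y p.1.1 * (if i = p.1.2 then 1 else 0))

/-- The polynomial map of degree two with coefficients `c`. -/
def quadPoly (c : JetIndex n → EuclideanSpace ℝ (Fin N)) (y : EuclideanSpace ℝ (Fin n)) :
    EuclideanSpace ℝ (Fin N) :=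
  ∑ s, quadMonomial s y • c s

@[fun_prop]
theorem contDiff_quadMonomial (s : JetIndex n) : ContDiff ℝ ∞ (quadMonomial s) := by
  rcases s with i | p <;> unfold quadMonomial <;> simp only <;> fun_prop

@[fun_prop]
theorem contDiff_quadMonomial₁ (i : Fin n) (s : JetIndex n) :
    ContDiff ℝ ∞ (quadMonomial₁ i s) := by
  rcases s with k | p <;> unfold quadMonomial₁ <;> simp only <;> fun_prop

@[fun_prop]
theorem contDiff_quadPoly (c : JetIndex n → EuclideanSpace ℝ (Fin N)) :
    ContDiff ℝ ∞ (quadPoly c) := by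
  unfold quadPoly
  fun_prop

theorem hasDerivAt_affine_mul_affine (a b c d : ℝ) :
    HasDerivAt (fun r : ℝ => (a + r * b) * (c + r * d)) (b * c + a * d) 0 := by
  have h := (((hasDerivAt_id (0 : ℝ)).mul_const b).const_add a).fun_mul
    (((hasDerivAt_id (0 : ℝ)).mul_const d).const_add c)
  simpa using h

theorem partialD_quadPoly (c : JetIndex n → EuclideanSpace ℝ (Fin N)) (i : Fin n) :
    partialD i (quadPoly c) = fun y => ∑ s, quadMonomial₁ i s y • c s := by
  ext1 y
  have h1 := ((contDiff_quadPoly c).differentiable (by simp) y).hasFDerivAt.hasLineDerivAt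
    (EuclideanSpace.single i 1)
  refine h1.unique ?_
  unfold HasLineDerivAt quadPoly
  refine HasDerivAt.fun_sum fun s _ => HasDerivAt.smul_const ?_ _
  rcases s with k | p
  · have h := ((hasDerivAt_id (0 : ℝ)).mul_const (if i = k then (1 : ℝ) else 0)).const_add (y k)
    simpa [quadMonomial, quadMonomial₁, Pi.single_apply, eq_comm] using h
  · have h := (hasDerivAt_affine_mul_affine (y p.1.1) (if i = p.1.1 then 1 else 0)
      (y p.1.2) (if i = p.1.2 then 1 else 0)).const_mul (if p.1.1 = p.1.2 then (1 / 2 : ℝ) else 1)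
    simpa [quadMonomial, quadMonomial₁, Pi.single_apply, eq_comm] using h

theorem jet_quadPoly_inl (c : JetIndex n → EuclideanSpace ℝ (Fin N)) (i : Fin n)
    (y : EuclideanSpace ℝ (Fin n)) :
    jet (quadPoly c) y (.inl i) = c (.inl i) + ∑ p, quadMonomial₁ i (.inr p) y • c (.inr p) := by
  simp [jet, partialD_quadPoly, quadMonomial₁]

theorem jet_quadPoly_inr (c : JetIndex n → EuclideanSpace ℝ (Fin N))
    (p : {p : Fin n × Fin n // p.1 ≤ p.2}) (y : EuclideanSpace ℝ (Fin n)) :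
    jet (quadPoly c) y (.inr p) = c (.inr p) := by
  have hd : ContDiff ℝ ∞ fun y => ∑ s, quadMonomial₁ p.1.2 s y • c s := by fun_prop
  have h1 := (hd.differentiable (by simp) y).hasFDerivAt.hasLineDerivAt
    (EuclideanSpace.single p.1.1 1)
  change partialD p.1.1 (partialD p.1.2 (quadPoly c)) y = _
  rw [partialD_quadPoly]
  refine h1.unique ?_
  have hsum : c (.inr p) = ∑ s, (if s = .inr p then (1 : ℝ) else 0) • c s := by simp
  rw [hsum]
  unfold HasLineDerivAt
  refine HasDerivAt.fun_sum fun s _ => HasDerivAt.smul_const ?_ _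
  rcases s with k | q
  · simpa [quadMonomial₁] using hasDerivAt_const (0 : ℝ) (if p.1.2 = k then (1 : ℝ) else 0)
  · have h := ((((hasDerivAt_id (0 : ℝ)).mul_const (if p.1.1 = q.1.2 then (1 : ℝ) else 0)).const_add
      (y q.1.2)).const_mul (if p.1.2 = q.1.1 then (1 : ℝ) else 0)).fun_add
      ((((hasDerivAt_id (0 : ℝ)).mul_const (if p.1.1 = q.1.1 then (1 : ℝ) else 0)).const_add
      (y q.1.1)).mul_const (if p.1.2 = q.1.2 then (1 : ℝ) else 0)) |>.const_mul
        (if q.1.1 = q.1.2 then (1 / 2 : ℝ) else 1)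
    have hval : (if (Sum.inr q : JetIndex n) = .inr p then (1 : ℝ) else 0)
        = (if q.1.1 = q.1.2 then (1 / 2 : ℝ) else 1) *
          ((if p.1.2 = q.1.1 then (1 : ℝ) else 0) * (1 * if p.1.1 = q.1.2 then (1 : ℝ) else 0)
          + (1 * if p.1.1 = q.1.1 then (1 : ℝ) else 0) * if p.1.2 = q.1.2 then (1 : ℝ) else 0) := by
      obtain ⟨⟨i, j⟩, hij⟩ := p
      obtain ⟨⟨k, l⟩, hkl⟩ := q
      simp only at hij hkl
      simp only [Sum.inr.injEq, Subtype.mk.injEq, Prod.mk.injEq]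
      split_ifs <;> grind
    rw [hval]
    convert h using 1
    ext r
    simp [quadMonomial₁, eq_comm]

/-- The coefficients `c` for which `F + quadPoly c` has the second-order jet `z` at `y`; the vector
`l` is ignored. -/
def jetCoefficients (F : EuclideanSpace ℝ (Fin n) → EuclideanSpace ℝ (Fin N))
    (x : EuclideanSpace ℝ (Fin n) × (FreeIndex n → ℝ) × (Fin N → JetIndex n → ℝ)) :
    JetIndex n → EuclideanSpace ℝ (Fin N)
  | .inl i => WithLp.toLp 2 (fun a => x.2.2 a (.inl i)) - jet F x.1 (.inl i)
      - ∑ p, quadMonomial₁ i (.inr p) x.1 •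
        (WithLp.toLp 2 (fun a => x.2.2 a (.inr p)) - jet F x.1 (.inr p))
  | .inr p => WithLp.toLp 2 (fun a => x.2.2 a (.inr p)) - jet F x.1 (.inr p)

theorem jetCoefficients_jet {F : EuclideanSpace ℝ (Fin n) → EuclideanSpace ℝ (Fin N)}
    {y : EuclideanSpace ℝ (Fin n)} (hF : ContDiffAt ℝ ∞ F y)
    (c : JetIndex n → EuclideanSpace ℝ (Fin N)) (l : FreeIndex n → ℝ) :
    jetCoefficients F (y, l, fun a s => jet (F + quadPoly c) y s a) = c := by
  have hj := jet_add hF (contDiff_quadPoly c).contDiffAt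
  ext s a
  rcases s with i | p
  · simp [jetCoefficients, hj, jet_quadPoly_inl, jet_quadPoly_inr]
  · simp [jetCoefficients, hj, jet_quadPoly_inr]

theorem contDiffAt_jetCoefficients {F : EuclideanSpace ℝ (Fin n) → EuclideanSpace ℝ (Fin N)}
    {x : EuclideanSpace ℝ (Fin n) × (FreeIndex n → ℝ) × (Fin N → JetIndex n → ℝ)}
    (hF : ContDiffAt ℝ ∞ F x.1) : ContDiffAt ℝ ∞ (jetCoefficients F) x := by
  have hz : ∀ s, ContDiffAt ℝ ∞ (fun x : EuclideanSpace ℝ (Fin n) × (FreeIndex n → ℝ) ×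
      (Fin N → JetIndex n → ℝ) => (WithLp.toLp 2 (fun a => x.2.2 a s) : EuclideanSpace ℝ (Fin N))
        - jet F x.1 s) x := by
    intro s
    refine ContDiffAt.sub ?_ ((contDiffAt_jet hF s).comp x contDiffAt_fst)
    exact ((PiLp.contDiff_toLp (𝕜 := ℝ) (n := ∞) (p := 2)).comp (f := fun x :
      EuclideanSpace ℝ (Fin n) × (FreeIndex n → ℝ) × (Fin N → JetIndex n → ℝ) =>
        fun a => x.2.2 a s) (by fun_prop)).contDiffAt
  rw [contDiffAt_pi]
  rintro (i | p)
  · refine (hz (.inl i)).sub (ContDiffAt.sum fun p _ => ContDiffAt.fun_smul ?_ (hz (.inr p)))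
    exact (contDiff_quadMonomial₁ i (.inr p)).contDiffAt.comp x contDiffAt_fst
  · exact hz (.inr p)

/-- In codimension larger than `n`, almost every quadratic perturbation is free: the perturbations
which are not form the image of the union of the finitely many sets `degenerateJets`, whose dimension
is smaller than that of the space of perturbations. -/
theorem dense_setOf_linearIndependent_freeVectors (hN : n + Fintype.card (FreeIndex n) ≤ N)
    {Ω : Set (EuclideanSpace ℝ (Fin n))}
    {F : EuclideanSpace ℝ (Fin n) → EuclideanSpace ℝ (Fin N)}
    (hF : ∀ y ∈ Ω, ContDiffAt ℝ ∞ F y) :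
    Dense {c : JetIndex n → EuclideanSpace ℝ (Fin N) |
      ∀ y ∈ Ω, LinearIndependent ℝ (freeVectors (F + quadPoly c) y)} := by
  -- for `n = 0` there is nothing to show, but the space of coefficients is a point, so that the
  -- empty set has full dimension
  rcases Nat.eq_zero_or_pos n with rfl | hn
  · convert dense_univ
    exact Set.eq_univ_of_forall fun c y _ => linearIndependent_empty_type
  have hJ : 0 < Fintype.card (JetIndex n) := by
    rw [Fintype.card_pos_iff]
    exact ⟨.inl ⟨0, hn⟩⟩
  have hNJ : 0 < N * Fintype.card (JetIndex n) := Nat.mul_pos (by omega) hJ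
  let B : Set (JetIndex n → EuclideanSpace ℝ (Fin N)) :=
    ⋃ j, ⋃ σ, jetCoefficients F '' (degenerateJets n N j σ ∩ {x | x.1 ∈ Ω})
  have hB : dimH B < Module.finrank ℝ (JetIndex n → EuclideanSpace ℝ (Fin N)) := by
    have hle : dimH B ≤ ((N * Fintype.card (JetIndex n) - 1 : ℕ) : ENNReal) := by
      simp only [B, dimH_iUnion]
      refine iSup_le fun j => iSup_le fun σ => ?_
      calc _ ≤ dimH (degenerateJets n N j σ ∩ {x | x.1 ∈ Ω}) := by
            refine dimH_image_le_of_locally_lipschitzOn fun x hx => ?_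
            obtain ⟨K, t, ht, hK⟩ := ((contDiffAt_jetCoefficients (hF x.1 hx.2)).of_le
              (m := 1) (by simp)).exists_lipschitzOnWith
            exact ⟨K, t, mem_nhdsWithin_of_mem_nhds ht, hK⟩
        _ ≤ dimH (degenerateJets n N j σ) := dimH_mono Set.inter_subset_left
        _ ≤ _ := dimH_degenerateJets_le j σ (by omega)
    refine hle.trans_lt ?_
    rw [Module.finrank_pi_fintype]
    simp only [finrank_euclideanSpace, Fintype.card_fin, Finset.sum_const, Finset.card_univ,
      smul_eq_mul]
    rw [mul_comm (Fintype.card _) N]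
    exact_mod_cast Nat.sub_lt hNJ one_pos
  refine (dense_compl_of_dimH_lt_finrank hB).mono fun c hc y hy => ?_
  by_contra hli
  obtain ⟨g, hg, j, hj⟩ := Fintype.not_linearIndependent_iff.1 hli
  -- normalise the relation
  let l : FreeIndex n → ℝ := fun t => (g j)⁻¹ * g t
  have hlj : l j = 1 := inv_mul_cancel₀ hj
  have hl0 : l ≠ 0 := fun h => by simp [h] at hlj
  have hrel : ∀ a, ∑ t, l t * freeMonomial (fun s => jet (F + quadPoly c) y s a) t = 0 := by
    intro a
    have := congrArg (fun v => (g j)⁻¹ * v a) hg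
    simp only [WithLp.ofLp_sum, WithLp.ofLp_smul, Finset.sum_apply, Pi.smul_apply,
      freeVectors_apply, smul_eq_mul, Finset.mul_sum, PiLp.zero_apply, mul_zero] at this
    simpa only [l, mul_assoc] using this
  choose σ hσ using fun a => exists_relation_eq_zero hl0 (hrel a)
  refine hc (Set.mem_iUnion.2 ⟨j, Set.mem_iUnion.2 ⟨σ,
    (y, l, fun a s => jet (F + quadPoly c) y s a), ⟨⟨hlj, hσ⟩, hy⟩, ?_⟩⟩)
  exact jetCoefficients_jet (hF y hy) c l

end Perturbation

/-! ### Change of coordinates -/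

section Coordinates

variable {n N : ℕ}

/-- The directions in which the vectors in the definition of freeness can be formed when coordinate
directions are replaced by arbitrary ones. -/
abbrev FreeDirections (n : ℕ) :=
  EuclideanSpace ℝ (Fin n) ⊕ (EuclideanSpace ℝ (Fin n) × EuclideanSpace ℝ (Fin n)) ⊕
    (EuclideanSpace ℝ (Fin n) × EuclideanSpace ℝ (Fin n)) ⊕
    (EuclideanSpace ℝ (Fin n) × EuclideanSpace ℝ (Fin n) × EuclideanSpace ℝ (Fin n))

/-- The vectors in the definition of freeness along arbitrary directions, for a map with first
derivative `D` and second derivative `H`. -/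
def directionalVectors (D : EuclideanSpace ℝ (Fin n) →L[ℝ] EuclideanSpace ℝ (Fin N))
    (H : EuclideanSpace ℝ (Fin n) →L[ℝ] EuclideanSpace ℝ (Fin n) →L[ℝ] EuclideanSpace ℝ (Fin N)) :
    FreeDirections n → EuclideanSpace ℝ (Fin N)
  | .inl u => D u
  | .inr (.inl p) => H p.1 p.2
  | .inr (.inr (.inl p)) => odot (D p.1) (D p.2)
  | .inr (.inr (.inr t)) => odot (D t.1) (H t.2.1 t.2.2) + odot (D t.2.1) (H t.1 t.2.2)
      + odot (D t.2.2) (H t.1 t.2.1)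

/-- The coordinate directions belonging to an index. -/
def coordinateDirections : FreeIndex n → FreeDirections n
  | .inl i => .inl (EuclideanSpace.single i 1)
  | .inr (.inl p) => .inr (.inl (EuclideanSpace.single p.1.1 1, EuclideanSpace.single p.1.2 1))
  | .inr (.inr (.inl p)) =>
      .inr (.inr (.inl (EuclideanSpace.single p.1.1 1, EuclideanSpace.single p.1.2 1)))
  | .inr (.inr (.inr t)) => .inr (.inr (.inr (EuclideanSpace.single t.1.1 1,
      EuclideanSpace.single t.1.2.1 1, EuclideanSpace.single t.1.2.2 1)))

theorem natCast_le_infty (j : ℕ) : (j : WithTop ℕ∞) ≤ ∞ :=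
  WithTop.coe_le_coe.2 (le_top : (j : ℕ∞) ≤ ⊤)

theorem partialD_partialD {F : EuclideanSpace ℝ (Fin n) → EuclideanSpace ℝ (Fin N)}
    {y : EuclideanSpace ℝ (Fin n)} (hF : ContDiffAt ℝ ∞ F y) (i j : Fin n) :
    partialD i (partialD j F) y
      = fderiv ℝ (fderiv ℝ F) y (EuclideanSpace.single i 1) (EuclideanSpace.single j 1) := by
  have hd : DifferentiableAt ℝ (fderiv ℝ F) y :=
    (hF.fderiv_right (m := ∞) (by simp)).differentiableAt (by simp)
  unfold partialD
  rw [fderiv_clm_apply hd (differentiableAt_const _)]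
  simp

theorem freeVectors_eq_directionalVectors
    {F : EuclideanSpace ℝ (Fin n) → EuclideanSpace ℝ (Fin N)}
    {y : EuclideanSpace ℝ (Fin n)} (hF : ContDiffAt ℝ ∞ F y) :
    freeVectors F y
      = directionalVectors (fderiv ℝ F y) (fderiv ℝ (fderiv ℝ F) y) ∘ coordinateDirections := by
  ext1 t
  rcases t with i | p | p | t
  · rfl
  · exact partialD_partialD hF _ _
  · rfl
  · simp only [freeVectors, partialD_partialD hF]
    rfl

theorem mem_of_isLinearMap {T : EuclideanSpace ℝ (Fin n) → EuclideanSpace ℝ (Fin N)}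
    (hT : IsLinearMap ℝ T) {W : Submodule ℝ (EuclideanSpace ℝ (Fin N))}
    (h : ∀ i, T (EuclideanSpace.single i 1) ∈ W) (u : EuclideanSpace ℝ (Fin n)) : T u ∈ W := by
  have hu : u = ∑ i, u i • EuclideanSpace.single i (1 : ℝ) := by
    ext j
    simp [Finset.sum_apply, Pi.single_apply]
  rw [hu]
  change IsLinearMap.mk' T hT _ ∈ W
  rw [map_sum]
  refine Submodule.sum_mem _ fun i _ => ?_
  rw [map_smul]
  exact W.smul_mem _ (h i)

theorem span_directionalVectors_coordinateDirections
    (D : EuclideanSpace ℝ (Fin n) →L[ℝ] EuclideanSpace ℝ (Fin N))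
    (H : EuclideanSpace ℝ (Fin n) →L[ℝ] EuclideanSpace ℝ (Fin n) →L[ℝ] EuclideanSpace ℝ (Fin N))
    (hH : ∀ u v, H u v = H v u) :
    Submodule.span ℝ (Set.range (directionalVectors D H ∘ coordinateDirections))
      = Submodule.span ℝ (Set.range (directionalVectors D H)) := by
  refine le_antisymm (Submodule.span_mono (Set.range_comp_subset_range _ _)) ?_
  rw [Submodule.span_le]
  set W := Submodule.span ℝ (Set.range (directionalVectors D H ∘ coordinateDirections)) with hW
  have hmem : ∀ t : FreeIndex n, directionalVectors D H (coordinateDirections t) ∈ W :=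
    fun t => Submodule.subset_span ⟨t, rfl⟩
  rintro _ ⟨u | ⟨u, v⟩ | ⟨u, v⟩ | ⟨u, v, w⟩, rfl⟩
  · exact mem_of_isLinearMap (IsLinearMap.mk (map_add D) (map_smul D)) (fun i => hmem (.inl i)) u
  · refine mem_of_isLinearMap (T := fun u => H u v) (by constructor <;> simp) (fun i => ?_) u
    refine mem_of_isLinearMap (T := fun v => H _ v) (by constructor <;> simp) (fun j => ?_) v
    rcases le_total i j with h | h
    · exact hmem (.inr (.inl ⟨(i, j), h⟩))
    · simp only [hH (EuclideanSpace.single i 1)]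
      exact hmem (.inr (.inl ⟨(j, i), h⟩))
  · refine mem_of_isLinearMap (T := fun u => odot (D u) (D v))
      (by constructor <;> intros <;> ext <;> simp [odot] <;> ring) (fun i => ?_) u
    refine mem_of_isLinearMap (T := fun v => odot (D _) (D v))
      (by constructor <;> intros <;> ext <;> simp [odot] <;> ring) (fun j => ?_) v
    rcases le_total i j with h | h
    · exact hmem (.inr (.inr (.inl ⟨(i, j), h⟩)))
    · have := hmem (.inr (.inr (.inl ⟨(j, i), h⟩)))
      convert this using 1
      ext a
      simp [directionalVectors, coordinateDirections, odot, mul_comm]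
  · refine mem_of_isLinearMap (T := fun u => odot (D u) (H v w) + odot (D v) (H u w)
      + odot (D w) (H u v)) (by constructor <;> intros <;> ext <;> simp [odot] <;> ring)
      (fun i => ?_) u
    refine mem_of_isLinearMap (T := fun v => odot (D _) (H v w) + odot (D v) (H _ w)
      + odot (D w) (H _ v)) (by constructor <;> intros <;> ext <;> simp [odot] <;> ring)
      (fun j => ?_) v
    refine mem_of_isLinearMap (T := fun w => odot (D _) (H _ w) + odot (D _) (H _ w)
      + odot (D w) (H _ _)) (by constructor <;> intros <;> ext <;> simp [odot] <;> ring)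
      (fun k => ?_) w
    have hsort : ∀ i' j' k' : Fin n, ∀ h : i' ≤ j' ∧ j' ≤ k',
        odot (D (EuclideanSpace.single i' 1))
            (H (EuclideanSpace.single j' 1) (EuclideanSpace.single k' 1))
          + odot (D (EuclideanSpace.single j' 1))
            (H (EuclideanSpace.single i' 1) (EuclideanSpace.single k' 1))
          + odot (D (EuclideanSpace.single k' 1))
            (H (EuclideanSpace.single i' 1) (EuclideanSpace.single j' 1)) ∈ W :=
      fun i' j' k' h => hmem (.inr (.inr (.inr ⟨(i', j', k'), h⟩)))
    have hji := hH (EuclideanSpace.single j 1) (EuclideanSpace.single i 1)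
    have hki := hH (EuclideanSpace.single k 1) (EuclideanSpace.single i 1)
    have hkj := hH (EuclideanSpace.single k 1) (EuclideanSpace.single j 1)
    rcases le_total i j with h1 | h1 <;> rcases le_total j k with h2 | h2 <;>
      rcases le_total i k with h3 | h3
    · exact hsort i j k ⟨h1, h2⟩
    · exact hsort i j k ⟨h1, h2⟩
    · convert hsort i k j ⟨h3, h2⟩ using 1
      simp only [hkj]
      abel
    · convert hsort k i j ⟨h3, h1⟩ using 1
      simp only [hkj, hki]
      abel
    · convert hsort j i k ⟨h1, h3⟩ using 1
      simp only [hji]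
      abel
    · convert hsort j k i ⟨h2, h3⟩ using 1
      simp only [hki, hji]
      abel
    · convert hsort k j i ⟨h2, h1⟩ using 1
      simp only [hji, hki, hkj]
      abel
    · convert hsort k j i ⟨h2, h1⟩ using 1
      simp only [hji, hki, hkj]
      abel

/-- The vectors belonging to a composition `G ∘ τ` lie in the span of those belonging to `G`; here
`A` and `Q` are the first and second derivative of `τ`. -/
theorem span_directionalVectors_comp_le
    {D D' : EuclideanSpace ℝ (Fin n) →L[ℝ] EuclideanSpace ℝ (Fin N)}
    {H H' : EuclideanSpace ℝ (Fin n) →L[ℝ] EuclideanSpace ℝ (Fin n) →L[ℝ]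
      EuclideanSpace ℝ (Fin N)}
    {A : EuclideanSpace ℝ (Fin n) →L[ℝ] EuclideanSpace ℝ (Fin n)}
    {Q : EuclideanSpace ℝ (Fin n) →L[ℝ] EuclideanSpace ℝ (Fin n) →L[ℝ] EuclideanSpace ℝ (Fin n)}
    (hD : ∀ u, D' u = D (A u)) (hH : ∀ u v, H' u v = H (A u) (A v) + D (Q u v)) :
    Submodule.span ℝ (Set.range (directionalVectors D' H'))
      ≤ Submodule.span ℝ (Set.range (directionalVectors D H)) := by
  rw [Submodule.span_le]
  set W := Submodule.span ℝ (Set.range (directionalVectors D H))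
  have h1 : ∀ u, D u ∈ W := fun u => Submodule.subset_span ⟨.inl u, rfl⟩
  have h2 : ∀ u v, H u v ∈ W := fun u v => Submodule.subset_span ⟨.inr (.inl (u, v)), rfl⟩
  have h3 : ∀ u v, odot (D u) (D v) ∈ W :=
    fun u v => Submodule.subset_span ⟨.inr (.inr (.inl (u, v))), rfl⟩
  have h4 : ∀ u v w, odot (D u) (H v w) + odot (D v) (H u w) + odot (D w) (H u v) ∈ W :=
    fun u v w => Submodule.subset_span ⟨.inr (.inr (.inr (u, v, w))), rfl⟩
  rintro _ ⟨u | ⟨u, v⟩ | ⟨u, v⟩ | ⟨u, v, w⟩, rfl⟩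
  · simpa [directionalVectors, hD] using h1 (A u)
  · simpa [directionalVectors, hH] using W.add_mem (h2 _ _) (h1 _)
  · simpa [directionalVectors, hD] using h3 (A u) (A v)
  · have := W.add_mem (h4 (A u) (A v) (A w)) (W.add_mem (W.add_mem (h3 (A u) (Q v w))
      (h3 (A v) (Q u w))) (h3 (A w) (Q u v)))
    change _ ∈ W
    convert this using 1
    ext a
    simp [directionalVectors, hD, hH, odot]
    ring

/-- Freeness of a composition `G ∘ τ` at `y` implies freeness of `G` at `τ y`: the vectors of `G`
span at least as large a space. -/
theorem linearIndependent_freeVectors_of_comp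
    {G : EuclideanSpace ℝ (Fin n) → EuclideanSpace ℝ (Fin N)}
    {τ : EuclideanSpace ℝ (Fin n) → EuclideanSpace ℝ (Fin n)} {y : EuclideanSpace ℝ (Fin n)}
    (hG : ContDiffAt ℝ ∞ G (τ y)) (hτ : ContDiffAt ℝ ∞ τ y)
    (h : LinearIndependent ℝ (freeVectors (G ∘ τ) y)) :
    LinearIndependent ℝ (freeVectors G (τ y)) := by
  have hsymm : ∀ {F : EuclideanSpace ℝ (Fin n) → EuclideanSpace ℝ (Fin N)}
      {z : EuclideanSpace ℝ (Fin n)}, ContDiffAt ℝ ∞ F z → ∀ u v,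
        fderiv ℝ (fderiv ℝ F) z u v = fderiv ℝ (fderiv ℝ F) z v u := fun hF =>
    hF.isSymmSndFDerivAt (by simpa using natCast_le_infty 2)
  have hspan : ∀ {F : EuclideanSpace ℝ (Fin n) → EuclideanSpace ℝ (Fin N)}
      {z : EuclideanSpace ℝ (Fin n)}, ContDiffAt ℝ ∞ F z →
        Submodule.span ℝ (Set.range (freeVectors F z)) = Submodule.span ℝ
          (Set.range (directionalVectors (fderiv ℝ F z) (fderiv ℝ (fderiv ℝ F) z))) := by
    intro F z hF
    rw [freeVectors_eq_directionalVectors hF,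
      span_directionalVectors_coordinateDirections _ _ (hsymm hF)]
  have hGd : DifferentiableAt ℝ G (τ y) := hG.differentiableAt (by simp)
  have hτd : DifferentiableAt ℝ τ y := hτ.differentiableAt (by simp)
  have hD : fderiv ℝ (G ∘ τ) =ᶠ[𝓝 y] fun z => (fderiv ℝ G (τ z)).comp (fderiv ℝ τ z) := by
    have h1 : ∀ᶠ z in 𝓝 y, ContDiffAt ℝ 1 G (τ z) := hτ.continuousAt.eventually
      ((hG.of_le (m := 1) (by simp)).eventually (by simp))
    have h2 : ∀ᶠ z in 𝓝 y, ContDiffAt ℝ 1 τ z := (hτ.of_le (by simp)).eventually (by simp)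
    filter_upwards [h1, h2] with z h1 h2
    exact fderiv_comp z (h1.differentiableAt (by simp)) (h2.differentiableAt (by simp))
  have hG2 : DifferentiableAt ℝ (fderiv ℝ G) (τ y) :=
    (hG.fderiv_right (m := ∞) (by simp)).differentiableAt (by simp)
  have hτ2 : DifferentiableAt ℝ (fderiv ℝ τ) y :=
    (hτ.fderiv_right (m := ∞) (by simp)).differentiableAt (by simp)
  have hH : ∀ u v, fderiv ℝ (fderiv ℝ (G ∘ τ)) y u v
      = fderiv ℝ (fderiv ℝ G) (τ y) (fderiv ℝ τ y u) (fderiv ℝ τ y v)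
        + fderiv ℝ G (τ y) (fderiv ℝ (fderiv ℝ τ) y u v) := by
    intro u v
    have h := (hG2.hasFDerivAt.comp y hτd.hasFDerivAt).clm_comp hτ2.hasFDerivAt
    rw [hD.fderiv_eq]
    erw [h.fderiv]
    simp [add_comm]
  rw [linearIndependent_iff_card_le_finrank_span, Set.finrank, hspan hG]
  rw [linearIndependent_iff_card_le_finrank_span, Set.finrank, hspan (hG.comp y hτ)] at h
  refine h.trans (Submodule.finrank_mono (span_directionalVectors_comp_le (fun u => ?_) hH))
  rw [hD.eq_of_nhds]
  rfl

end Coordinates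

/-! ### Maps on a manifold in charts -/

universe u

section Charts

variable {n N : ℕ} {M : Type u} [TopologicalSpace M] [ChartedSpace (EuclideanSpace ℝ (Fin n)) M]

theorem contDiffAt_comp_symm {E : Type*} [NormedAddCommGroup E] [NormedSpace ℝ E] {f : M → E}
    {φ : OpenPartialHomeomorph M (EuclideanSpace ℝ (Fin n))}
    (hφ : φ ∈ IsManifold.maximalAtlas (𝓡 n) ∞ M) {x : M} (hx : x ∈ φ.source)
    (hf : ContMDiffAt (𝓡 n) 𝓘(ℝ, E) ∞ f x) : ContDiffAt ℝ ∞ (f ∘ φ.symm) (φ x) := by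
  rw [← contMDiffAt_iff_contDiffAt]
  have h := (contMDiffOn_symm_of_mem_maximalAtlas hφ).contMDiffAt
    (φ.open_target.mem_nhds (φ.map_source hx))
  refine ContMDiffAt.comp _ ?_ h
  rwa [φ.left_inv hx]

theorem contMDiffAt_of_mem_maximalAtlas'
    {φ : OpenPartialHomeomorph M (EuclideanSpace ℝ (Fin n))}
    (hφ : φ ∈ IsManifold.maximalAtlas (𝓡 n) ∞ M) {x : M} (hx : x ∈ φ.source) :
    ContMDiffAt (𝓡 n) (𝓡 n) ∞ φ x :=
  (contMDiffOn_of_mem_maximalAtlas hφ).contMDiffAt (φ.open_source.mem_nhds hx)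

/-- Linear independence of the vectors in the definition of freeness does not depend on the
chart. -/
theorem linearIndependent_freeVectors_of_chart {f : M → EuclideanSpace ℝ (Fin N)}
    (hf : ContMDiff (𝓡 n) (𝓡 N) ∞ f)
    {φ ψ : OpenPartialHomeomorph M (EuclideanSpace ℝ (Fin n))}
    (hφ : φ ∈ IsManifold.maximalAtlas (𝓡 n) ∞ M) (hψ : ψ ∈ IsManifold.maximalAtlas (𝓡 n) ∞ M)
    {x : M} (hxφ : x ∈ φ.source) (hxψ : x ∈ ψ.source)
    (h : LinearIndependent ℝ (freeVectors (f ∘ φ.symm) (φ x))) :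
    LinearIndependent ℝ (freeVectors (f ∘ ψ.symm) (ψ x)) := by
  have hτ : ContDiffAt ℝ ∞ (ψ ∘ φ.symm) (φ x) :=
    contDiffAt_comp_symm hφ hxφ (contMDiffAt_of_mem_maximalAtlas' hψ hxψ)
  have hval : (ψ ∘ φ.symm) (φ x) = ψ x := by simp [φ.left_inv hxφ]
  have hG : ContDiffAt ℝ ∞ (f ∘ ψ.symm) ((ψ ∘ φ.symm) (φ x)) := by
    rw [hval]
    exact contDiffAt_comp_symm hψ hxψ hf.contMDiffAt
  have heq : f ∘ φ.symm =ᶠ[𝓝 (φ x)] (f ∘ ψ.symm) ∘ (ψ ∘ φ.symm) := by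
    have hc : ContinuousAt φ.symm (φ x) := φ.continuousAt_symm (φ.map_source hxφ)
    have : ∀ᶠ y in 𝓝 (φ x), φ.symm y ∈ ψ.source := by
      refine hc.eventually_mem (ψ.open_source.mem_nhds ?_)
      rwa [φ.left_inv hxφ]
    filter_upwards [this] with y hy
    simp [ψ.left_inv hy]
  rw [freeVectors_congr heq] at h
  rw [← hval]
  exact linearIndependent_freeVectors_of_comp hG hτ h

/-- The vectors `freeVectors F y` as a function of the second-order jet of `F` at `y`. -/
def freeVectorsOfJet (z : JetIndex n → EuclideanSpace ℝ (Fin N)) (t : FreeIndex n) :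
    EuclideanSpace ℝ (Fin N) :=
  WithLp.toLp 2 fun a => freeMonomial (fun s => z s a) t

theorem freeVectorsOfJet_jet (F : EuclideanSpace ℝ (Fin n) → EuclideanSpace ℝ (Fin N))
    (y : EuclideanSpace ℝ (Fin n)) : freeVectorsOfJet (jet F y) = freeVectors F y := by
  ext t a
  rw [freeVectors_apply]
  rfl

theorem continuous_freeVectorsOfJet :
    Continuous (freeVectorsOfJet (n := n) (N := N)) := by
  refine continuous_pi fun t => (PiLp.continuous_toLp 2 _).comp (continuous_pi fun a => ?_)
  rcases t with i | p | p | t <;> simp only [freeMonomial] <;> fun_prop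

theorem norm_jet_sub_le {F G : EuclideanSpace ℝ (Fin n) → EuclideanSpace ℝ (Fin N)}
    {y : EuclideanSpace ℝ (Fin n)} (hF : ContDiffAt ℝ ∞ F y) (hG : ContDiffAt ℝ ∞ G y) {ε : ℝ}
    (h : ∀ k ≤ 2, ‖iteratedFDeriv ℝ k G y - iteratedFDeriv ℝ k F y‖ < ε) :
    ‖jet G y - jet F y‖ < ε := by
  have hε : 0 < ε := (norm_nonneg _).trans_lt (h 0 (by simp))
  rw [pi_norm_lt_iff hε]
  rintro (i | p)
  · refine lt_of_le_of_lt ?_ (h 1 (by simp))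
    have := (iteratedFDeriv ℝ 1 G y - iteratedFDeriv ℝ 1 F y).le_opNorm
      fun _ => EuclideanSpace.single i 1
    simpa [jet, partialD] using this
  · refine lt_of_le_of_lt ?_ (h 2 le_rfl)
    have := (iteratedFDeriv ℝ 2 G y - iteratedFDeriv ℝ 2 F y).le_opNorm
      ![EuclideanSpace.single p.1.1 1, EuclideanSpace.single p.1.2 1]
    simpa [jet, partialD_partialD hF, partialD_partialD hG, iteratedFDeriv_two_apply] using this

/-- Freeness on a compact subset of a chart domain is stable under perturbations which are small in
the `C^2`-norm. -/
theorem exists_pos_linearIndependent_freeVectors {f : M → EuclideanSpace ℝ (Fin N)}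
    (hf : ContMDiff (𝓡 n) (𝓡 N) ∞ f) {φ : OpenPartialHomeomorph M (EuclideanSpace ℝ (Fin n))}
    (hφ : φ ∈ IsManifold.maximalAtlas (𝓡 n) ∞ M) {K : Set M} (hK : IsCompact K)
    (hKφ : K ⊆ φ.source)
    (h : ∀ x ∈ K, LinearIndependent ℝ (freeVectors (f ∘ φ.symm) (φ x))) :
    ∃ ε > 0, ∀ g : M → EuclideanSpace ℝ (Fin N), ContMDiff (𝓡 n) (𝓡 N) ∞ g →
      (∀ x ∈ K, ∀ k ≤ 2, ‖iteratedFDeriv ℝ k (g ∘ φ.symm) (φ x)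
        - iteratedFDeriv ℝ k (f ∘ φ.symm) (φ x)‖ < ε) →
      ∀ x ∈ K, LinearIndependent ℝ (freeVectors (g ∘ φ.symm) (φ x)) := by
  have hopen : IsOpen {z : JetIndex n → EuclideanSpace ℝ (Fin N) |
      LinearIndependent ℝ (freeVectorsOfJet z)} :=
    isOpen_setOfPred_linearIndependent.preimage continuous_freeVectorsOfJet
  have hcont : ContinuousOn (fun x => jet (f ∘ φ.symm) (φ x)) K := by
    refine continuousOn_pi.2 fun s x hx => ContinuousAt.continuousWithinAt ?_
    exact (contDiffAt_jet (contDiffAt_comp_symm hφ (hKφ hx) hf.contMDiffAt) s).continuousAt.comp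
      (φ.continuousAt (hKφ hx))
  obtain ⟨ε, hε, hsub⟩ := (hK.image_of_continuousOn hcont).exists_thickening_subset_open hopen (by
    rintro _ ⟨x, hx, rfl⟩
    simpa [freeVectorsOfJet_jet] using h x hx)
  refine ⟨ε, hε, fun g hg hgf x hx => ?_⟩
  rw [← freeVectorsOfJet_jet]
  refine hsub (Metric.mem_thickening_iff.2 ⟨_, ⟨x, hx, rfl⟩, ?_⟩)
  rw [dist_eq_norm]
  exact norm_jet_sub_le (contDiffAt_comp_symm hφ (hKφ hx) hf.contMDiffAt)
    (contDiffAt_comp_symm hφ (hKφ hx) hg.contMDiffAt) (hgf x hx)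

end Charts

/-! ### Bump functions and perturbations of maps on a manifold -/

/-- A locally finite family of smooth functions `χ k` with compact supports in chart domains, and
compact sets `V k` covering the manifold such that `χ k` is equal to one near `V k`. -/
structure BumpCover (n : ℕ) (M : Type u) [TopologicalSpace M]
    [ChartedSpace (EuclideanSpace ℝ (Fin n)) M] (ι : Type u) where
  /-- The charts. -/
  ψ : ι → OpenPartialHomeomorph M (EuclideanSpace ℝ (Fin n))
  /-- The bump functions. -/
  χ : ι → M → ℝ
  /-- The compact sets. -/
  V : ι → Set M
  chart : ∀ k, ψ k ∈ IsManifold.maximalAtlas (𝓡 n) ∞ M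
  contMDiff : ∀ k, ContMDiff (𝓡 n) 𝓘(ℝ, ℝ) ∞ (χ k)
  tsupport_subset : ∀ k, tsupport (χ k) ⊆ (ψ k).source
  compact_tsupport : ∀ k, IsCompact (tsupport (χ k))
  locallyFinite : LocallyFinite fun k => tsupport (χ k)
  compact : ∀ k, IsCompact (V k)
  eventuallyEq_one : ∀ k, ∀ x ∈ V k, χ k =ᶠ[𝓝 x] 1
  iUnion_eq : ⋃ k, V k = Set.univ

theorem exists_bumpCover (n : ℕ) (M : Type u) [TopologicalSpace M] [T2Space M]
    [SecondCountableTopology M] [ChartedSpace (EuclideanSpace ℝ (Fin n)) M]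
    [IsManifold (𝓡 n) ∞ M] : ∃ (ι : Type u) (_ : BumpCover n M ι), Countable ι := by
  have : LocallyCompactSpace M := ChartedSpace.locallyCompactSpace (EuclideanSpace ℝ (Fin n)) M
  obtain ⟨ι, b, -⟩ := SmoothBumpCovering.exists_isSubordinate (𝓡 n) (M := M) isClosed_univ
    (U := fun _ => Set.univ) (fun _ _ => Filter.univ_mem)
  have hone : ∀ k x, b k =ᶠ[𝓝 x] 1 → x ∈ Function.support (b k) := fun k x hx => by
    simp [hx.eq_of_nhds]
  obtain ⟨V, hVu, hVc, hV⟩ := exists_iUnion_eq_closed_subset (u := fun k => interior {x | b k x = 1})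
    (fun k => isOpen_interior)
    (fun x => (b.locallyFinite.point_finite x).subset fun k hk =>
      hone k x (mem_interior_iff_mem_nhds.1 hk))
    (Set.eq_univ_of_forall fun x => by
      obtain ⟨k, hk⟩ := b.eventuallyEq_one' x (Set.mem_univ x)
      exact Set.mem_iUnion.2 ⟨k, mem_interior_iff_mem_nhds.2 hk⟩)
  refine ⟨ι, ⟨fun k => chartAt _ (b.c k), fun k => b k, V, fun k =>
    IsManifold.chart_mem_maximalAtlas _, fun k => (b k).contMDiff, fun k =>
    (b k).tsupport_subset_chartAt_source, fun k => (b k).hasCompactSupport,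
    b.locallyFinite.closure, fun k => ?_, fun k x hx => mem_interior_iff_mem_nhds.1 (hV k hx),
    hVu⟩, ?_⟩
  · refine (b k).hasCompactSupport.isCompact.of_isClosed_subset (hVc k) fun x hx => ?_
    exact subset_tsupport _ (hone k x (mem_interior_iff_mem_nhds.1 (hV k hx)))
  · exact Set.countable_univ_iff.1
      (b.locallyFinite.countable_univ fun k => (b k).nonempty_support)

namespace BumpCover

variable {n N : ℕ} {M : Type u} [TopologicalSpace M] [ChartedSpace (EuclideanSpace ℝ (Fin n)) M]
  {ι : Type u} (b : BumpCover n M ι)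

theorem subset_tsupport (k : ι) : b.V k ⊆ tsupport (b.χ k) := fun x hx =>
  _root_.subset_tsupport _ (by simp [(b.eventuallyEq_one k x hx).eq_of_nhds])

theorem subset_source (k : ι) : b.V k ⊆ (b.ψ k).source :=
  (b.subset_tsupport k).trans (b.tsupport_subset k)

theorem isWhitneyData {ε : ι → ℝ} (hε : ∀ k, 0 < ε k) : IsWhitneyData b.ψ b.V ε :=
  ⟨b.chart, b.compact, b.subset_source, b.locallyFinite.subset b.subset_tsupport, hε⟩

/-- The monomial of index `s` in the chart `k`, cut off by the bump function. -/
def monomial (k : ι) (s : JetIndex n) (x : M) : ℝ := b.χ k x * quadMonomial s (b.ψ k x)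

theorem monomial_eq_zero {k : ι} {x : M} (hx : x ∉ tsupport (b.χ k)) (s : JetIndex n) :
    b.monomial k s x = 0 := by
  simp [monomial, image_eq_zero_of_notMem_tsupport hx]

/-- The sum over all charts of the cut-off quadratic maps with coefficients `c`. -/
def perturbation (c : ι → JetIndex n → EuclideanSpace ℝ (Fin N)) (x : M) :
    EuclideanSpace ℝ (Fin N) :=
  ∑ᶠ k, ∑ s, b.monomial k s x • c k s

theorem support_subset (c : ι → JetIndex n → EuclideanSpace ℝ (Fin N)) (x : M) :
    (Function.support fun k => ∑ s, b.monomial k s x • c k s) ⊆ {k | x ∈ tsupport (b.χ k)} := by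
  intro k hk
  by_contra hx
  exact hk (by simp [b.monomial_eq_zero hx])

theorem perturbation_add (c c' : ι → JetIndex n → EuclideanSpace ℝ (Fin N)) :
    b.perturbation (c + c') = b.perturbation c + b.perturbation c' := by
  ext1 x
  have hfin : {k | x ∈ tsupport (b.χ k)}.Finite := b.locallyFinite.point_finite x
  simp only [perturbation, Pi.add_apply, smul_add, Finset.sum_add_distrib]
  exact finsum_add_distrib (hfin.subset (b.support_subset c x))
    (hfin.subset (b.support_subset c' x))

theorem perturbation_single [DecidableEq ι] (k : ι) (p : JetIndex n → EuclideanSpace ℝ (Fin N))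
    (x : M) : b.perturbation (Pi.single k p) x = b.χ k x • quadPoly p (b.ψ k x) := by
  unfold perturbation
  rw [finsum_eq_single _ k fun k' hk' => by simp [Pi.single_eq_of_ne hk']]
  simp [monomial, quadPoly, Finset.smul_sum, smul_smul]

theorem contMDiff_monomial (k : ι) (s : JetIndex n) :
    ContMDiff (𝓡 n) 𝓘(ℝ, ℝ) ∞ (b.monomial k s) := by
  refine contMDiff_of_tsupport fun x hx => ?_
  have hx' : x ∈ tsupport (b.χ k) := tsupport_mul_subset_left hx
  refine (b.contMDiff k).contMDiffAt.mul ?_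
  exact (contDiff_quadMonomial s).contMDiff.contMDiffAt.comp x
    (contMDiffAt_of_mem_maximalAtlas' (b.chart k) (b.tsupport_subset k hx'))

theorem contMDiff_perturbation (c : ι → JetIndex n → EuclideanSpace ℝ (Fin N)) :
    ContMDiff (𝓡 n) (𝓡 N) ∞ (b.perturbation c) := by
  refine contMDiff_finsum (fun k => ?_) (b.locallyFinite.subset fun k x hx => b.support_subset c x hx)
  exact contMDiff_finsetSum fun s _ => (b.contMDiff_monomial k s).smul contMDiff_const

/-- On a compact set the derivatives of the perturbation with coefficients `c` are controlled by
those finitely many `c k` whose bump function does not vanish near the compact set. -/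
theorem exists_norm_iteratedFDeriv_perturbation_le
    {φ : OpenPartialHomeomorph M (EuclideanSpace ℝ (Fin n))}
    (hφ : φ ∈ IsManifold.maximalAtlas (𝓡 n) ∞ M) {K : Set M} (hK : IsCompact K)
    (hKφ : K ⊆ φ.source) (r : ℕ) :
    ∃ (T : Finset ι) (A : ℝ), (∀ k ∈ T, (tsupport (b.χ k) ∩ K).Nonempty) ∧ 0 ≤ A ∧
      ∀ c : ι → JetIndex n → EuclideanSpace ℝ (Fin N), ∀ x ∈ K, ∀ j ≤ r,
        ‖iteratedFDeriv ℝ j (b.perturbation c ∘ φ.symm) (φ x)‖ ≤ A * ∑ k ∈ T, ‖c k‖ := by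
  have hfin := b.locallyFinite.finite_nonempty_inter_compact hK
  have hsmooth : ∀ k s, ∀ x ∈ K, ContDiffAt ℝ ∞ (b.monomial k s ∘ φ.symm) (φ x) := fun k s x hx =>
    contDiffAt_comp_symm hφ (hKφ hx) (b.contMDiff_monomial k s).contMDiffAt
  have hbound : ∀ k s j, ∃ C : ℝ, ∀ x ∈ K,
      ‖iteratedFDeriv ℝ j (b.monomial k s ∘ φ.symm) (φ x)‖ ≤ C := by
    intro k s j
    refine hK.exists_bound_of_continuousOn
      (f := fun x => iteratedFDeriv ℝ j (b.monomial k s ∘ φ.symm) (φ x)) fun x hx => ?_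
    refine ContinuousAt.continuousWithinAt ?_
    have h := (hsmooth k s x hx).iteratedFDeriv_right (m := 0) (i := j) (by simpa using natCast_le_infty j)
    exact h.continuousAt.comp (φ.continuousAt (hKφ hx))
  choose C hC using hbound
  refine ⟨hfin.toFinset, ∑ k ∈ hfin.toFinset, ∑ s, ∑ j ∈ Finset.range (r + 1), |C k s j|,
    fun k hk => by simpa using hk, by positivity, fun c x hx j hj => ?_⟩
  -- the supports of the other bump functions have a closed union, which is disjoint from `K`
  have hclosed : IsClosed (⋃ k : {k // k ∉ hfin.toFinset}, tsupport (b.χ k)) :=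
    (b.locallyFinite.comp_injective Subtype.val_injective).isClosed_iUnion
      fun k => isClosed_tsupport _
  have hxc : x ∉ ⋃ k : {k // k ∉ hfin.toFinset}, tsupport (b.χ k) := by
    rw [Set.mem_iUnion]
    rintro ⟨⟨k, hk⟩, hxk⟩
    exact hk (by simpa using ⟨x, hxk, hx⟩)
  have hcont : ContinuousAt φ.symm (φ x) := φ.continuousAt_symm (φ.map_source (hKφ hx))
  have hev : b.perturbation c ∘ φ.symm =ᶠ[𝓝 (φ x)] fun y => ∑ k ∈ hfin.toFinset, ∑ s,
      (b.monomial k s ∘ φ.symm) y • c k s := by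
    have hx' : ∀ᶠ y in 𝓝 (φ x), φ.symm y ∉ ⋃ k : {k // k ∉ hfin.toFinset}, tsupport (b.χ k) := by
      refine hcont.eventually_mem (hclosed.isOpen_compl.mem_nhds ?_)
      rwa [φ.left_inv (hKφ hx)]
    filter_upwards [hx'] with y hy
    refine finsum_eq_sum_of_support_subset _ fun k hk => ?_
    by_contra hk'
    exact hy (Set.mem_iUnion.2 ⟨⟨k, hk'⟩, b.support_subset c _ hk⟩)
  have hterm : ∀ k s, ContDiffAt ℝ ∞ (fun y => (b.monomial k s ∘ φ.symm) y • c k s) (φ x) :=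
    fun k s => (hsmooth k s x hx).smul contDiffAt_const
  have hj' : (j : WithTop ℕ∞) ≤ ∞ := natCast_le_infty j
  have hev' : iteratedFDeriv ℝ j (b.perturbation c ∘ φ.symm) (φ x) = iteratedFDeriv ℝ j
      (fun y => ∑ k ∈ hfin.toFinset, ∑ s, (b.monomial k s ∘ φ.symm) y • c k s) (φ x) :=
    (hev.iteratedFDeriv ℝ j).eq_of_nhds
  rw [hev', iteratedFDeriv_fun_sum_apply fun k _ =>
    (ContDiffAt.sum fun s _ => hterm k s).of_le hj', Finset.mul_sum]
  refine (norm_sum_le _ _).trans (Finset.sum_le_sum fun k hk => ?_)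
  rw [iteratedFDeriv_fun_sum_apply fun s _ => (hterm k s).of_le hj']
  calc _ ≤ ∑ s, ‖iteratedFDeriv ℝ j (fun y => (b.monomial k s ∘ φ.symm) y • c k s) (φ x)‖ :=
        norm_sum_le _ _
    _ ≤ ∑ s, (∑ j ∈ Finset.range (r + 1), |C k s j|) * ‖c k‖ := by
        refine Finset.sum_le_sum fun s _ => ?_
        have h := (ContinuousLinearMap.toSpanSingleton ℝ (c k s)).norm_iteratedFDeriv_comp_left
          (hsmooth k s x hx) hj'
        rw [ContinuousLinearMap.norm_toSpanSingleton] at h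
        refine h.trans ?_
        rw [mul_comm]
        have hCj : |C k s j| ≤ ∑ j ∈ Finset.range (r + 1), |C k s j| :=
          Finset.single_le_sum (f := fun j => |C k s j|) (fun _ _ => abs_nonneg _)
            (Finset.mem_range.2 (Nat.lt_succ_of_le hj))
        exact mul_le_mul (((hC k s j x hx).trans (le_abs_self _)).trans hCj) (norm_le_pi_norm _ _)
          (norm_nonneg _) (by positivity)
    _ = (∑ s, ∑ j ∈ Finset.range (r + 1), |C k s j|) * ‖c k‖ := by rw [Finset.sum_mul]
    _ ≤ _ := by
        refine mul_le_mul_of_nonneg_right ?_ (norm_nonneg _)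
        exact Finset.single_le_sum (f := fun k => ∑ s, ∑ j ∈ Finset.range (r + 1), |C k s j|)
          (fun _ _ => by positivity) hk

end BumpCover

/-! ### Openness -/

section Whitney

variable {n N : ℕ} {M : Type u} [TopologicalSpace M] [ChartedSpace (EuclideanSpace ℝ (Fin n)) M]
  {ι : Type u} (b : BumpCover n M ι)

namespace BumpCover

/-- Freeness need only be checked in one chart around each point. -/
theorem isFreeStatistical_of_forall {f : SmoothMaps n N M}
    (h : ∀ k, ∀ x ∈ b.V k, LinearIndependent ℝ (freeVectors (f ∘ (b.ψ k).symm) (b.ψ k x))) :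
    IsFreeStatistical f := by
  intro x φ hφ hx
  obtain ⟨k, hk⟩ := Set.mem_iUnion.1 (b.iUnion_eq.ge (Set.mem_univ x))
  exact linearIndependent_freeVectors_of_chart f.contMDiff (b.chart k) hφ (b.subset_source k hk) hx
    (h k x hk)

theorem isOpen_setOf_isFreeStatistical (b : BumpCover n M ι) :
    IsOpen[whitneyTopology n N M] {f : SmoothMaps n N M | IsFreeStatistical f} := by
  intro f hf
  have h := fun k => exists_pos_linearIndependent_freeVectors f.contMDiff (b.chart k) (b.compact k)
    (b.subset_source k) fun x hx => hf x _ (b.chart k) (b.subset_source k hx)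
  choose ε hε hg using h
  exact ⟨2, ι, b.ψ, b.V, ε, b.isWhitneyData hε, fun g hgf => b.isFreeStatistical_of_forall
    fun k => hg k g g.contMDiff (hgf k)⟩

/-! ### Density -/

/-- The perturbation of `f` with coefficients `c`. -/
def perturb (f : SmoothMaps n N M) (c : ι → JetIndex n → EuclideanSpace ℝ (Fin N)) :
    SmoothMaps n N M :=
  ⟨f + b.perturbation c, f.contMDiff.add (b.contMDiff_perturbation c)⟩

theorem coe_perturb (f : SmoothMaps n N M) (c : ι → JetIndex n → EuclideanSpace ℝ (Fin N)) :
    ⇑(b.perturb f c) = f + b.perturbation c := rfl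

theorem coe_perturb_add (f : SmoothMaps n N M)
    (c c' : ι → JetIndex n → EuclideanSpace ℝ (Fin N)) :
    ⇑(b.perturb f (c + c')) = b.perturb f c + b.perturbation c' := by
  rw [coe_perturb, coe_perturb, perturbation_add, add_assoc]

theorem iteratedFDeriv_perturb_add_sub (f : SmoothMaps n N M)
    (c c' : ι → JetIndex n → EuclideanSpace ℝ (Fin N))
    {φ : OpenPartialHomeomorph M (EuclideanSpace ℝ (Fin n))}
    (hφ : φ ∈ IsManifold.maximalAtlas (𝓡 n) ∞ M) {x : M} (hx : x ∈ φ.source) (j : ℕ) :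
    iteratedFDeriv ℝ j (b.perturb f (c + c') ∘ φ.symm) (φ x)
        - iteratedFDeriv ℝ j (b.perturb f c ∘ φ.symm) (φ x)
      = iteratedFDeriv ℝ j (b.perturbation c' ∘ φ.symm) (φ x) := by
  have h1 := (contDiffAt_comp_symm hφ hx (b.perturb f c).contMDiff.contMDiffAt).of_le
    (natCast_le_infty j)
  have h2 := (contDiffAt_comp_symm hφ hx (b.contMDiff_perturbation c').contMDiffAt).of_le
    (natCast_le_infty j)
  have h : ⇑(b.perturb f (c + c')) ∘ φ.symm
      = ⇑(b.perturb f c) ∘ φ.symm + b.perturbation c' ∘ φ.symm := by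
    rw [coe_perturb_add]
    rfl
  rw [h, iteratedFDeriv_add_apply h1 h2, add_sub_cancel_left]

/-- The coefficients for which the perturbation of `f` is free on the compact set `V k`. -/
def freeCoefficients (f : SmoothMaps n N M) (k : ι) :
    Set (ι → JetIndex n → EuclideanSpace ℝ (Fin N)) :=
  {c | ∀ x ∈ b.V k,
    LinearIndependent ℝ (freeVectors (b.perturb f c ∘ (b.ψ k).symm) (b.ψ k x))}

theorem isOpen_freeCoefficients (f : SmoothMaps n N M) (k : ι) :
    IsOpen (b.freeCoefficients f k) := by
  rw [isOpen_iff_mem_nhds]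
  intro c hc
  obtain ⟨ε, hε, hg⟩ := exists_pos_linearIndependent_freeVectors (b.perturb f c).contMDiff
    (b.chart k) (b.compact k) (b.subset_source k) hc
  obtain ⟨T, A, -, -, hA⟩ := b.exists_norm_iteratedFDeriv_perturbation_le (N := N) (b.chart k)
    (b.compact k) (b.subset_source k) 2
  have hcont : Continuous fun c' : ι → JetIndex n → EuclideanSpace ℝ (Fin N) =>
    A * ∑ k ∈ T, ‖(c' - c) k‖ := by
    simp only [Pi.sub_apply]
    fun_prop
  have hnear : ∀ᶠ c' in 𝓝 c, A * ∑ k ∈ T, ‖(c' - c) k‖ < ε :=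
    hcont.continuousAt.eventually_lt continuousAt_const (by simpa using hε)
  filter_upwards [hnear] with c' hc'
  refine hg _ (b.perturb f c').contMDiff fun x hx j hj => ?_
  have h := b.iteratedFDeriv_perturb_add_sub f c (c' - c) (b.chart k) (b.subset_source k hx) j
  rw [add_sub_cancel] at h
  rw [h]
  exact (hA _ x hx j hj).trans_lt hc'

/-- Changing only the coefficients belonging to the chart `k` suffices to make the map free on
`V k`, since there the corresponding part of the perturbation is an arbitrary quadratic map. -/
theorem dense_freeCoefficients_update [DecidableEq ι]
    (hN : n + Fintype.card (FreeIndex n) ≤ N) (f : SmoothMaps n N M) (k : ι)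
    (c : ι → JetIndex n → EuclideanSpace ℝ (Fin N)) :
    Dense {p | Function.update c k p ∈ b.freeCoefficients f k} := by
  have hF : ∀ y ∈ b.ψ k '' b.V k,
      ContDiffAt ℝ ∞ (b.perturb f (Function.update c k 0) ∘ (b.ψ k).symm) y := by
    rintro _ ⟨x, hx, rfl⟩
    exact contDiffAt_comp_symm (b.chart k) (b.subset_source k hx)
      (b.perturb f _).contMDiff.contMDiffAt
  refine (dense_setOf_linearIndependent_freeVectors hN hF).mono fun p hp x hx => ?_
  have hsplit : Function.update c k p = Function.update c k 0 + Pi.single k p := by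
    ext1 k'
    by_cases h : k' = k
    · subst h; simp
    · simp [h]
  have hxs := b.subset_source k hx
  have heq : b.perturb f (Function.update c k p) ∘ (b.ψ k).symm =ᶠ[𝓝 (b.ψ k x)]
      b.perturb f (Function.update c k 0) ∘ (b.ψ k).symm + quadPoly p := by
    have h1 : ∀ᶠ y in 𝓝 (b.ψ k x), b.χ k ((b.ψ k).symm y) = 1 := by
      have hc : Filter.Tendsto (b.ψ k).symm (𝓝 (b.ψ k x)) (𝓝 x) := by
        simpa [(b.ψ k).left_inv hxs] using
          ((b.ψ k).continuousAt_symm ((b.ψ k).map_source hxs)).tendsto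
      exact hc.eventually (b.eventuallyEq_one k x hx)
    filter_upwards [h1, (b.ψ k).open_target.mem_nhds ((b.ψ k).map_source hxs)] with y hy hyt
    rw [Function.comp_apply, hsplit, coe_perturb_add]
    simp [perturbation_single, hy, (b.ψ k).right_inv hyt]
  rw [freeVectors_congr heq]
  exact hp _ ⟨x, hx, rfl⟩

/-- The coefficients in a product of balls form a compact space, in which by Baire's theorem some
point makes the map free on all the countably many sets `V k`. -/
theorem exists_isFreeStatistical_perturb [Countable ι]
    (hN : n + Fintype.card (FreeIndex n) ≤ N) (f : SmoothMaps n N M) {δ : ι → ℝ}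
    (hδ : ∀ k, 0 < δ k) :
    ∃ c : ι → JetIndex n → EuclideanSpace ℝ (Fin N), (∀ k, ‖c k‖ ≤ δ k) ∧
      IsFreeStatistical (b.perturb f c) := by
  classical
  let C := ∀ k, Metric.closedBall (0 : JetIndex n → EuclideanSpace ℝ (Fin N)) (δ k)
  have hcompact : ∀ k, CompactSpace
      (Metric.closedBall (0 : JetIndex n → EuclideanSpace ℝ (Fin N)) (δ k)) := fun k =>
    isCompact_iff_compactSpace.1 (isCompact_closedBall _ _)
  have hne : Nonempty C := ⟨fun k => ⟨0, Metric.mem_closedBall_self (hδ k).le⟩⟩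
  let val : C → ι → JetIndex n → EuclideanSpace ℝ (Fin N) := fun c k => c k
  have hval : Continuous val := continuous_pi fun k => continuous_subtype_val.comp (continuous_apply k)
  have hdense : ∀ k, Dense (val ⁻¹' b.freeCoefficients f k) := by
    intro k
    rw [dense_iff_inter_open]
    rintro O hO ⟨c, hc⟩
    have hcont : Continuous fun p : Metric.closedBall
        (0 : JetIndex n → EuclideanSpace ℝ (Fin N)) (δ k) => (Function.update c k p : C) :=
      continuous_const.update k continuous_id
    obtain ⟨O', hO', hOO'⟩ := isOpen_induced_iff.1 (hO.preimage hcont)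
    have hck : (c k : JetIndex n → EuclideanSpace ℝ (Fin N)) ∈ O' := by
      have : c k ∈ Subtype.val ⁻¹' O' := by
        rw [hOO']
        simpa using hc
      exact this
    have hcl : (c k : JetIndex n → EuclideanSpace ℝ (Fin N)) ∈ closure (Metric.ball 0 (δ k)) := by
      rw [closure_ball _ (hδ k).ne']
      exact (c k).2
    have hnonempty := mem_closure_iff.1 hcl O' hO' hck
    obtain ⟨p, hp, hpO⟩ := (b.dense_freeCoefficients_update hN f k (val c)).exists_mem_open
      (hO'.inter Metric.isOpen_ball) hnonempty
    have hpb := Metric.ball_subset_closedBall hpO.2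
    refine ⟨Function.update c k ⟨p, hpb⟩, ?_, ?_⟩
    · have : (⟨p, hpb⟩ : Metric.closedBall _ _) ∈ Subtype.val ⁻¹' O' := hpO.1
      rw [hOO'] at this
      exact this
    · have : val (Function.update c k ⟨p, hpb⟩) = Function.update (val c) k p := by
        ext1 k'
        by_cases h : k' = k
        · subst h; simp [val]
        · simp [val, h]
      rw [Set.mem_preimage, this]
      exact hp
  obtain ⟨c, hc⟩ := (dense_iInter_of_isOpen
    (fun k => (b.isOpen_freeCoefficients f k).preimage hval) hdense).nonempty
  exact ⟨val c, fun k => mem_closedBall_zero_iff.1 (c k).2,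
    b.isFreeStatistical_of_forall fun k => Set.mem_iInter.1 hc k⟩

theorem dense_setOf_isFreeStatistical (b : BumpCover n M ι) [Countable ι]
    (hN : n + Fintype.card (FreeIndex n) ≤ N) :
    @Dense _ (whitneyTopology n N M) {f : SmoothMaps n N M | IsFreeStatistical f} := by
  let _ := whitneyTopology n N M
  rw [dense_iff_inter_open]
  rintro U hU ⟨f, hf⟩
  obtain ⟨r, ι', φ, K, ε, hd, hs⟩ := hU f hf
  choose T A hT hA0 hA using fun i => b.exists_norm_iteratedFDeriv_perturbation_le (N := N)
    (hd.chart i) (hd.compact i) (hd.subset i) r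
  -- each support meets only finitely many `K i`, so finitely many bounds on each coefficient suffice
  have hδ : ∀ k, ∃ δ > 0, ∀ i, k ∈ T i → δ ≤ ε i / (A i * (T i).card + 1) := by
    intro k
    have hfin : {i | k ∈ T i}.Finite :=
      (hd.locallyFinite.finite_nonempty_inter_compact (b.compact_tsupport k)).subset fun i hi => by
        rw [Set.mem_ofPred_eq, Set.inter_comm]
        exact hT i k hi
    have hpos : ∀ i, 0 < ε i / (A i * (T i).card + 1) := fun i =>
      div_pos (hd.pos i) (by have := hA0 i; positivity)
    have hev : ∀ᶠ δ in 𝓝[>] (0 : ℝ), ∀ i ∈ {i | k ∈ T i}, δ ≤ ε i / (A i * (T i).card + 1) :=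
      hfin.eventually_all.2 fun i _ =>
        mem_nhdsWithin_of_mem_nhds (Iic_mem_nhds (hpos i))
    obtain ⟨δ, h1, h2⟩ := (hev.and self_mem_nhdsWithin).exists
    exact ⟨δ, h2, h1⟩
  choose δ hδ0 hδ using hδ
  obtain ⟨c, hc, hfree⟩ := b.exists_isFreeStatistical_perturb hN f hδ0
  refine ⟨b.perturb f c, hs fun i x hx j hj => ?_, hfree⟩
  have h := b.iteratedFDeriv_perturb_add_sub f 0 c (hd.chart i) (hd.subset i hx) j
  have hzero : ⇑(b.perturb f 0) = f := by
    ext1 y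
    simp [coe_perturb, perturbation]
  rw [zero_add, hzero] at h
  rw [h]
  have hden : 0 < A i * (T i).card + 1 := by have := hA0 i; positivity
  calc _ ≤ A i * ∑ k ∈ T i, ‖c k‖ := hA i c x hx j hj
    _ ≤ A i * ∑ k ∈ T i, ε i / (A i * (T i).card + 1) :=
        mul_le_mul_of_nonneg_left
          (Finset.sum_le_sum fun k hk => (hc k).trans (hδ k i hk)) (hA0 i)
    _ = ε i * (A i * (T i).card) / (A i * (T i).card + 1) := by
        rw [Finset.sum_const, nsmul_eq_mul]
        ring
    _ < ε i := by
        rw [div_lt_iff₀ hden]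
        nlinarith [hd.pos i]

end BumpCover

end Whitney

end FreeStat

end

theorem proposition3p2 {n N : ℕ} (hN : (n * (n ^ 2 + 9 * n + 20) : ℝ) / 6 ≤ N)
    {M : Type*} [TopologicalSpace M] [T2Space M] [SecondCountableTopology M]
    [ChartedSpace (EuclideanSpace ℝ (Fin n)) M] [IsManifold (𝓡 n) ∞ M] :
    IsOpen[FreeStat.whitneyTopology n N M]
        {f : FreeStat.SmoothMaps n N M | FreeStat.IsFreeStatistical f} ∧
      @Dense _ (FreeStat.whitneyTopology n N M)
        {f : FreeStat.SmoothMaps n N M | FreeStat.IsFreeStatistical f} := by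
  have hcard : n + Fintype.card (FreeStat.FreeIndex n) ≤ N := by
    have h := FreeStat.six_mul_card_freeIndex_le n
    have hN' : n * (n ^ 2 + 9 * n + 20) ≤ 6 * N := by
      rw [div_le_iff₀ (by norm_num)] at hN
      have : (n * (n ^ 2 + 9 * n + 20) : ℝ) ≤ 6 * N := by linarith
      exact_mod_cast this
    nlinarith
  obtain ⟨ι, b, hι⟩ := FreeStat.exists_bumpCover n M
  exact ⟨b.isOpen_setOf_isFreeStatistical, b.dense_setOf_isFreeStatistical hcard⟩
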